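/- **Conventions.** For a small category $\Lambda$ with object set $\Lambda^0$ (identified with the identity morphisms), $s(\alpha)$ and $r(\alpha)$ are the domain and codomain of a morphism $\alpha$, $\alpha\beta$ is defined when $s(\alpha)=r(\beta)$, $\alpha\Lambda=\{\alpha\beta : r(\beta)=s(\alpha)\}$, $v\Lambda=\{\beta: r(\beta)=v\}$ for $v\in\Lambda^0$, $\alpha\le\beta$ means $\beta\in\alpha\Lambda$, and $\alpha\Cap\beta$ means $\alpha\Lambda\cap\beta\Lambda\neq\emptyset$. $\Lambda$ is *left cancellative* if $\alpha\beta=\alpha\gamma$ implies $\beta=\gamma$, and *finitely aligned* if each $\alpha\Lambda\cap\beta\Lambda$ is a finite union of sets $\gamma\Lambda$. Let $\Gamma$ be a submonoid of a group $Q$ with $\Gamma\cap\Gamma^{-1}=\{1\}$. A *length function* is a map $\mathbf d:\Lambda\to\Gamma$ with $\mathbf d(\alpha\beta)=\mathbf d(\alpha)\mathbf d(\beta)$. $\mathrm{PIso}(\Lambda,\mathbf d)$ is the groupoid (under composition, with unit space $\Lambda^0$) of the bijections $f:v\Lambda\to w\Lambda$ ($v,w\in\Lambda^0$) with $f(\alpha\Lambda)=f(\alpha)\Lambda$,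 $f(v)=w$ and $\mathbf d(f(\alpha))=\mathbf d(\alpha)$. An *action* of a discrete groupoid $\mathcal G$ on $\Lambda$ is a groupoid homomorphism $\phi:\mathcal G\to\mathrm{PIso}(\Lambda,\mathbf d)$ that restricts to a bijection of the unit spaces, by which $\mathcal G^{(0)}$ is identified with $\Lambda^0$; write $g\cdot\alpha=\phi(g)(\alpha)$ for $s(g)=r(\alpha)$. A *category cocycle* is a map $\varphi:\{(g,\alpha)\in\mathcal G\times\Lambda:s(g)=r(\alpha)\}\to\mathcal G$ such that, whenever the expressions involved are defined, $s(\varphi(g,\alpha))=s(\alpha)$, $r(\varphi(g,\alpha))=s(g\cdot\alpha)$, $\varphi(gh,\alpha)=\varphi(g,h\cdot\alpha)\varphi(h,\alpha)$, $\varphi(g,s(g))=g$, $\varphi(r(\alpha),\alpha)=s(\alpha)$, $\varphi(g,\alpha\beta)=\varphi(\varphi(g,\alpha),\beta)$ and $g\cdot(\alpha\beta)=(g\cdot\alpha)(\varphi(g,\alpha)\cdot\beta)$; then $(\Lambda,\mathbf d,\mathcal G,\varphi)$ is a *category system*. Its *Zappa-Szép product* $\Lambda\Join^\varphi\mathcal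 G$ is the small category of pairs $(\alpha,g)\in\Lambda\times\mathcal G$ with $s(\alpha)=r(g)$, with $r(\alpha,g)=r(\alpha)$, $s(\alpha,g)=s(g)$ and $(\alpha,g)(\beta,h)=(\alpha(g\cdot\beta),\varphi(g,\beta)h)$; it is left cancellative, and finitely aligned if $\Lambda$ is. For a finitely aligned left cancellative small category $\Delta$, let $\mathcal S_\Delta$ be the inverse semigroup of partial bijections of $\Delta$ generated by $\tau^\alpha:s(\alpha)\Delta\to\alpha\Delta$, $\beta\mapsto\alpha\beta$, and $\sigma^\alpha=(\tau^\alpha)^{-1}$ ($\alpha\in\Delta$). Let $\Delta^*$ be the set of nonempty, hereditary, upwards directed subsets of $(\Delta,\le)$, $\Delta^{**}$ the set of its maximal elements with respect to inclusion, and $\Delta_{tight}$ the set of those $F\in\Delta^*$ such that for all $\alpha\in F$ and all finite $X\subset\Delta$ with $X\cap F=\emptyset$ there is $D\in\Delta^{**}$ with $\alpha\in D$ and $D\cap X=\emptyset$; its topology is generated by the sets $\{F:\alpha\in F\}$ and $\{F:\alpha\notin F\}$, $\alpha\in\Delta$. If $F\cap\mathrm{dom}(s)\ne\emptyset$, put $s\cdot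 F=\{\delta:\delta\le s(\gamma)\text{ for some }\gamma\in F\cap\mathrm{dom}(s)\}$. The *tight groupoid* $\mathcal G_{tight}(\Delta)$ is the groupoid of germs $[s,F]$, $s\in\mathcal S_\Delta$, $F\in\Delta_{tight}$, $F\cap\mathrm{dom}(s)\neq\emptyset$, where $[s,F]=[t,G]$ iff $F=G$ and $se=te$ for some idempotent $e\in\mathcal S_\Delta$ with $F\cap\mathrm{dom}(e)\ne\emptyset$; its operations are $[s,t\cdot G][t,G]=[st,G]$ and $[s,F]^{-1}=[s^{-1},s\cdot F]$, and its topology is generated by the sets $\{[s,F]:F\in U,\ F\cap\mathrm{dom}(s)\ne\emptyset\}$ with $s\in\mathcal S_\Delta$ and $U\subseteq\Delta_{tight}$ open. **Proposition.** Let $\Lambda$ be a finitely aligned left cancellative small category with length function $\mathbf d:\Lambda\to\Gamma$, let $\mathcal G$ be a discrete groupoid acting on $\Lambda$, let $(\Lambda,\mathbf d,\mathcal G,\varphi)$ be a category system, and let $\Lambda\Join^\varphi\mathcal G$ be its Zappa-Szép product. Then $\mathcal G_{tight}(\Lambda\Join^\varphi\mathcal G)$ is Hausdorff if and only if for all $\alpha,\beta\in\Lambda$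 and $g\in\mathcal G$ with $g^{-1}\cdot s(\alpha)=s(\beta)$ (that is, $r(g)=s(\alpha)$ and $s(g)=s(\beta)$) there is a finite set $H\subset s(\beta)\Lambda$ such that 1. $\alpha(g\cdot\gamma)=\beta\gamma$ and $\varphi(g,\gamma)=s(\gamma)$ for every $\gamma\in H$; 2. for every $\delta\in s(\beta)\Lambda$ with $\alpha(g\cdot\delta)=\beta\delta$ and $\varphi(g,\delta)=s(\delta)$ there is $\gamma\in H$ with $\delta\Cap\gamma$. -/

import Mathlib

open CategoryTheory

namespace LCSC

universe v u v' u' w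

/-! ## Morphisms of a small category, initial segments, finite alignment

A small category `Λ` is a Mathlib category `C`; `Mor C` is the set of all its morphisms.
For `α : Mor C`, `α.src` is `s(α)` and `α.tgt` is `r(α)`; `α.comp β` is the product `αβ`
(first `β`, then `α`), defined when `s(α) = r(β)`. -/

/-- The set of all morphisms of the category `C`. -/
structure Mor (C : Type u) [Category.{v} C] where
  {src : C}
  {tgt : C}
  hom : src ⟶ tgt

namespace Mor

variable {C : Type u} [Category.{v} C]

/-- The identity morphism at `x`. -/
abbrev id (x : C) : Mor C := ⟨𝟙 x⟩

/-- The product `αβ`, defined when `s(α) = r(β)`. -/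
abbrev comp (α β : Mor C) (h : α.src = β.tgt) : Mor C :=
  ⟨β.hom ≫ eqToHom h.symm ≫ α.hom⟩

theorem comp_src (α β : Mor C) (h : α.src = β.tgt) : (α.comp β h).src = β.src := rfl
theorem comp_tgt (α β : Mor C) (h : α.src = β.tgt) : (α.comp β h).tgt = α.tgt := rfl

theorem comp_assoc (α β γ : Mor C) (h : α.src = β.tgt) (h' : β.src = γ.tgt) :
    (α.comp β h).comp γ h' = α.comp (β.comp γ h') h := by
  obtain ⟨α⟩ := α; obtain ⟨β⟩ := β; obtain ⟨γ⟩ := γ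
  dsimp only at h h'
  subst h; subst h'
  simp only [comp, eqToHom_refl, Category.id_comp, Category.assoc]

theorem id_comp (α : Mor C) (x : C) (h : x = α.tgt) : (id x).comp α h = α := by
  obtain ⟨α⟩ := α
  dsimp only at h
  subst h
  simp only [comp, eqToHom_refl, Category.comp_id]

theorem comp_id (α : Mor C) (x : C) (h : α.src = x) : α.comp (id x) h = α := by
  obtain ⟨α⟩ := α
  dsimp only at h
  subst h
  simp only [comp, eqToHom_refl, Category.id_comp]

theorem comp_congr {α α' β β' : Mor C} (hα : α = α') (hβ : β = β') (h : α.src = β.tgt) :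
    α.comp β h = α'.comp β' (hα ▸ hβ ▸ h) := by
  subst hα; subst hβ; rfl

/-- `α ≤ β` means that `α` is an initial segment of `β`, that is `β = αγ` for some `γ`.
So `Set.Ici α` is `αΛ`, and `Set.Iic β` is `[β]`. -/
instance : Preorder (Mor C) where
  le α β := ∃ (γ : Mor C) (h : α.src = γ.tgt), β = α.comp γ h
  le_refl α := ⟨id α.src, rfl, (comp_id α _ rfl).symm⟩
  le_trans := by
    rintro α _ _ ⟨γ, h, rfl⟩ ⟨δ, h', rfl⟩
    exact ⟨γ.comp δ h', h, comp_assoc _ _ _ _ _⟩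

theorem le_def {α β : Mor C} : α ≤ β ↔ ∃ (γ : Mor C) (h : α.src = γ.tgt), β = α.comp γ h :=
  Iff.rfl

theorem le_comp (α γ : Mor C) (h : α.src = γ.tgt) : α ≤ α.comp γ h := ⟨γ, h, rfl⟩

/-- `α ⋓ β`: the sets `αΛ` and `βΛ` intersect. -/
def Meets (α β : Mor C) : Prop := (Set.Ici α ∩ Set.Ici β).Nonempty

end Mor

/-- `C` is left cancellative: `αβ = αγ` implies `β = γ`. -/
class LeftCancellative (C : Type u) [Category.{v} C] : Prop where
  cancel : ∀ (α β γ : Mor C) (h : α.src = β.tgt) (h' : α.src = γ.tgt),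
    α.comp β h = α.comp γ h' → β = γ

/-- `C` is finitely aligned: every `αΛ ∩ βΛ` is a finite union of sets `γΛ`. -/
class FinitelyAligned (C : Type u) [Category.{v} C] : Prop where
  aligned : ∀ α β : Mor C, ∃ Γ : Set (Mor C), Γ.Finite ∧
    Set.Ici α ∩ Set.Ici β = ⋃ γ ∈ Γ, Set.Ici γ

/-! ## The inverse semigroup of a left cancellative small category

The symmetric inverse semigroup on a set `X` is `X ≃. X` (partial bijections). -/

section InverseSemigroup

variable {C : Type u} [Category.{v} C] [LeftCancellative C]

open Classical in
/-- `τ^α : s(α)Λ → αΛ`, `β ↦ αβ`. -/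
noncomputable def prepend (α : Mor C) : Mor C ≃. Mor C where
  toFun β := if h : α.src = β.tgt then some (α.comp β h) else none
  invFun γ := if h : α ≤ γ then some h.choose else none
  inv β γ := by
    constructor
    · intro hβ
      by_cases h : α ≤ γ
      · have hβ' : h.choose = β := by simpa [h] using hβ
        obtain ⟨h1, h2⟩ := h.choose_spec
        rw [← hβ']
        exact (dif_pos h1).trans (congrArg some h2.symm)
      · simp [h] at hβ
    · intro hγ
      by_cases h : α.src = β.tgt
      · have hγ' : α.comp β h = γ := by simpa [h] using hγ
        have hle : α ≤ γ := ⟨β, h, hγ'.symm⟩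
        obtain ⟨h1, h2⟩ := hle.choose_spec
        refine (dif_pos hle).trans (congrArg some (LeftCancellative.cancel α _ _ h1 h (h2.symm.trans hγ'.symm)))
      · simp [h] at hγ

/-- `σ^α : αΛ → s(α)Λ`, `αβ ↦ β`. -/
noncomputable def shift (α : Mor C) : Mor C ≃. Mor C := (prepend α).symm

open Classical in
theorem mem_prepend {α β γ : Mor C} :
    γ ∈ prepend α β ↔ ∃ h : α.src = β.tgt, α.comp β h = γ := by
  change γ ∈ (if h : α.src = β.tgt then some (α.comp β h) else none) ↔ _
  by_cases h : α.src = β.tgt <;> simp [h]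

theorem mem_shift {α β γ : Mor C} :
    γ ∈ shift α β ↔ ∃ h : α.src = γ.tgt, α.comp γ h = β := by
  rw [shift, PEquiv.mem_iff_mem, mem_prepend]

/-- Membership in the subsemigroup of the symmetric inverse semigroup on `Λ` generated by the
maps `σ^α` and `τ^α`; this set of generators is closed under inverses. -/
inductive IsGenerated : (Mor C ≃. Mor C) → Prop
  | shift (α : Mor C) : IsGenerated (shift α)
  | prepend (α : Mor C) : IsGenerated (prepend α)
  | comp {s t : Mor C ≃. Mor C} : IsGenerated s → IsGenerated t → IsGenerated (t.trans s)

theorem IsGenerated.symm {s : Mor C ≃. Mor C} (hs : IsGenerated s) : IsGenerated s.symm := by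
  induction hs with
  | shift α => exact .prepend α
  | prepend α => exact .shift α
  | comp _ _ hs ht => exact .comp ht hs

variable (C) in
/-- The inverse semigroup `S_Λ = ⟨σ^α, τ^α : α ∈ Λ⟩`. -/
structure InvSemigroup where
  map : Mor C ≃. Mor C
  gen : IsGenerated map

namespace InvSemigroup

/-- The product `st` is the composition `s ∘ t`. -/
instance : Mul (InvSemigroup C) := ⟨fun s t => ⟨t.map.trans s.map, .comp s.gen t.gen⟩⟩

/-- The involution `s ↦ s*`. -/
instance : Inv (InvSemigroup C) := ⟨fun s => ⟨s.map.symm, s.gen.symm⟩⟩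

/-- The domain of `s`. -/
def dom (s : InvSemigroup C) : Set (Mor C) := {γ | ∃ δ, δ ∈ s.map γ}

@[ext] theorem ext {s t : InvSemigroup C} (h : ∀ γ, s.map γ = t.map γ) : s = t := by
  obtain ⟨s, _⟩ := s; obtain ⟨t, _⟩ := t
  obtain rfl : s = t := PEquiv.ext h
  rfl

theorem mem_mul {s t : InvSemigroup C} {γ ε : Mor C} :
    ε ∈ (s * t).map γ ↔ ∃ δ, δ ∈ t.map γ ∧ ε ∈ s.map δ := PEquiv.mem_trans _ _ _ _

theorem mem_inv {s : InvSemigroup C} {γ δ : Mor C} : δ ∈ s⁻¹.map γ ↔ γ ∈ s.map δ :=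
  PEquiv.mem_iff_mem _

theorem inv_inv' (s : InvSemigroup C) : s⁻¹⁻¹ = s := by
  obtain ⟨s, _⟩ := s; rfl

theorem mul_assoc' (s t q : InvSemigroup C) : (s * t) * q = s * (t * q) :=
  InvSemigroup.ext fun γ => by
    change (q.map.trans (t.map.trans s.map)) γ = ((q.map.trans t.map).trans s.map) γ
    rw [PEquiv.trans_assoc]

theorem lift_le (s : InvSemigroup C) {γ γ' δ : Mor C} (h : γ ≤ γ') (hδ : δ ∈ s.map γ) :
    ∃ δ', δ' ∈ s.map γ' ∧ δ ≤ δ' := by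
  obtain ⟨s, hs⟩ := s
  change δ ∈ s γ at hδ
  change ∃ δ', δ' ∈ s γ' ∧ δ ≤ δ'
  induction hs generalizing γ γ' δ with
  | shift α =>
    obtain ⟨h1, rfl⟩ := mem_shift.1 hδ
    obtain ⟨η, h2, rfl⟩ := h
    exact ⟨δ.comp η h2, mem_shift.2 ⟨h1, (Mor.comp_assoc _ _ _ _ _).symm⟩, Mor.le_comp _ _ _⟩
  | prepend α =>
    obtain ⟨h1, rfl⟩ := mem_prepend.1 hδ
    obtain ⟨η, h2, rfl⟩ := h
    exact ⟨_, mem_prepend.2 ⟨h1, rfl⟩, ⟨η, h2, (Mor.comp_assoc _ _ _ _ _).symm⟩⟩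
  | comp _ _ hs ht =>
    obtain ⟨ε, h1, h2⟩ := (PEquiv.mem_trans _ _ _ _).1 hδ
    obtain ⟨ε', h3, h4⟩ := ht h h1
    obtain ⟨δ', h5, h6⟩ := hs h4 h2
    exact ⟨δ', (PEquiv.mem_trans _ _ _ _).2 ⟨ε', h3, h5⟩, h6⟩

theorem lift_le_inv (s : InvSemigroup C) {γ δ δ' : Mor C} (h : δ ≤ δ') (hδ : δ ∈ s.map γ) :
    ∃ γ', δ' ∈ s.map γ' ∧ γ ≤ γ' := by
  obtain ⟨γ', h1, h2⟩ := s⁻¹.lift_le h (mem_inv.2 hδ)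
  exact ⟨γ', mem_inv.1 h1, h2⟩

theorem le_of_le (s : InvSemigroup C) {γ γ' δ δ' : Mor C} (h : δ ≤ δ') (hδ : δ ∈ s.map γ)
    (hδ' : δ' ∈ s.map γ') : γ ≤ γ' := by
  obtain ⟨γ'', h1, h2⟩ := s.lift_le_inv h hδ
  rwa [s.map.inj hδ' h1]

theorem eq_of_idem {e : InvSemigroup C} (he : e * e = e) {γ δ : Mor C} (h : δ ∈ e.map γ) :
    δ = γ := by
  rw [← he, mem_mul] at h
  obtain ⟨ε, h1, h2⟩ := h
  have h3 : δ ∈ e.map γ := by rw [← he, mem_mul]; exact ⟨ε, h1, h2⟩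
  exact (Option.mem_unique h3 h1).trans (e.map.inj h2 h3)

/-- The idempotent `τ^γ σ^γ`. -/
noncomputable def proj (γ : Mor C) : InvSemigroup C :=
  ⟨(shift γ).trans (prepend γ), .comp (.prepend γ) (.shift γ)⟩

theorem mem_proj {γ δ ε : Mor C} : ε ∈ (proj γ).map δ ↔ ε = δ ∧ γ ≤ δ := by
  change ε ∈ ((shift γ).trans (prepend γ)) δ ↔ _
  rw [PEquiv.mem_trans]
  simp only [mem_shift, mem_prepend]
  constructor
  · rintro ⟨η, ⟨h1, rfl⟩, h2, rfl⟩
    exact ⟨rfl, Mor.le_comp _ _ _⟩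
  · rintro ⟨rfl, η, h, rfl⟩
    exact ⟨η, ⟨h, rfl⟩, h, rfl⟩

theorem proj_idem (γ : Mor C) : proj γ * proj γ = proj γ := by
  refine InvSemigroup.ext fun δ => Option.ext fun ε => ?_
  change ε ∈ (proj γ * proj γ).map δ ↔ ε ∈ (proj γ).map δ
  rw [mem_mul]
  simp only [mem_proj]
  constructor
  · rintro ⟨_, ⟨rfl, h⟩, rfl, _⟩
    exact ⟨rfl, h⟩
  · rintro ⟨rfl, h⟩
    exact ⟨ε, ⟨rfl, h⟩, rfl, h⟩

end InvSemigroup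

end InverseSemigroup

/-! ## Tight hereditary directed sets

The nonempty hereditary upwards directed subsets of `Λ` are the order ideals of `Mor C`
(`Order.Ideal`); the maximal ones are the maximal elements (`IsMax`) for inclusion. -/

/-- `F` is tight: for all `α ∈ F` and all finite `X` disjoint from `F`, there is a maximal
hereditary directed set that contains `α` and is disjoint from `X`. -/
def IsTight {C : Type u} [Category.{v} C] (F : Order.Ideal (Mor C)) : Prop :=
  ∀ α ∈ F, ∀ X : Set (Mor C), X.Finite → Disjoint (F : Set (Mor C)) X →
    ∃ D : Order.Ideal (Mor C), IsMax D ∧ α ∈ D ∧ Disjoint (D : Set (Mor C)) X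

/-- The set `Λ_tight` of tight hereditary directed sets. -/
structure TightSpace (C : Type u) [Category.{v} C] where
  carrier : Order.Ideal (Mor C)
  tight : IsTight carrier

theorem tight_ext {C : Type u} [Category.{v} C] {F G : TightSpace C}
    (h : F.carrier = G.carrier) : F = G := by
  obtain ⟨F, _⟩ := F; obtain ⟨G, _⟩ := G
  obtain rfl : F = G := h
  rfl

/-- The topology of `Λ_tight`, generated by the sets `{F : α ∈ F}` and their complements; a basis
is given by the sets `{F : X ⊆ F, Y ∩ F = ∅}` for finite `X, Y ⊆ Λ`. -/
instance {C : Type u} [Category.{v} C] : TopologicalSpace (TightSpace C) :=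
  TopologicalSpace.generateFrom
    ({U | ∃ α, U = {F | α ∈ F.carrier}} ∪ {U | ∃ α, U = {F | α ∉ F.carrier}})

/-! ## The action of the inverse semigroup on tight sets -/

section Action

variable {C : Type u} [Category.{v} C] [LeftCancellative C]

/-- `F` lies in the domain of the action of `s`. -/
def InDom (s : InvSemigroup C) (F : Order.Ideal (Mor C)) : Prop :=
  ((F : Set (Mor C)) ∩ s.dom).Nonempty

/-- `s · F`, the union of the sets `[s(γ)]` over `γ ∈ F ∩ dom(s)`. -/
def actIdeal (s : InvSemigroup C) (F : Order.Ideal (Mor C)) (h : InDom s F) :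
    Order.Ideal (Mor C) where
  carrier := {δ | ∃ γ ∈ F, ∃ ε, ε ∈ s.map γ ∧ δ ≤ ε}
  lower' := by
    rintro δ δ' hle ⟨γ, hγ, ε, hε, h⟩
    exact ⟨γ, hγ, ε, hε, hle.trans h⟩
  nonempty' := by
    obtain ⟨γ, hγ, ε, hε⟩ := h
    exact ⟨ε, γ, hγ, ε, hε, le_rfl⟩
  directed' := by
    rintro δ₁ ⟨γ₁, hγ₁, ε₁, hε₁, h₁⟩ δ₂ ⟨γ₂, hγ₂, ε₂, hε₂, h₂⟩
    obtain ⟨γ, hγ, hle₁, hle₂⟩ := F.directed γ₁ hγ₁ γ₂ hγ₂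
    obtain ⟨ε, hε, h₁'⟩ := s.lift_le hle₁ hε₁
    obtain ⟨ε', hε', h₂'⟩ := s.lift_le hle₂ hε₂
    obtain rfl := Option.mem_unique hε hε'
    exact ⟨ε, ⟨γ, hγ, ε, hε, le_rfl⟩, h₁.trans h₁', h₂.trans h₂'⟩

theorem mem_actIdeal {s : InvSemigroup C} {F : Order.Ideal (Mor C)} {h : InDom s F}
    {δ : Mor C} : δ ∈ actIdeal s F h ↔ ∃ γ ∈ F, ∃ ε, ε ∈ s.map γ ∧ δ ≤ ε := Iff.rfl

theorem inDom_proj {γ : Mor C} {F : TightSpace C} (h : γ ∈ F.carrier) :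
    InDom (.proj γ) F.carrier := ⟨γ, h, γ, InvSemigroup.mem_proj.2 ⟨rfl, le_rfl⟩⟩

theorem inDom_inv {s : InvSemigroup C} {F : Order.Ideal (Mor C)} (h : InDom s F) :
    InDom s⁻¹ (actIdeal s F h) := by
  obtain ⟨γ, hγ, ε, hε⟩ := h
  exact ⟨ε, ⟨γ, hγ, ε, hε, le_rfl⟩, γ, InvSemigroup.mem_inv.2 hε⟩

theorem actIdeal_inv {s : InvSemigroup C} {F : Order.Ideal (Mor C)} (h : InDom s F)
    (h' : InDom s⁻¹ (actIdeal s F h)) : actIdeal s⁻¹ (actIdeal s F h) h' = F := by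
  refine SetLike.ext fun δ => ⟨?_, fun hδ => ?_⟩
  · rintro ⟨ζ, ⟨γ, hγ, ε, hε, hle⟩, η, hη, hle'⟩
    rw [InvSemigroup.mem_inv] at hη
    exact F.lower (hle'.trans (s.le_of_le hle hη hε)) hγ
  · obtain ⟨γ, hγ, ε, hε⟩ := h
    obtain ⟨γ', hγ', h1, h2⟩ := F.directed γ hγ δ hδ
    obtain ⟨ε', hε', -⟩ := s.lift_le h1 hε
    exact ⟨ε', ⟨γ', hγ', ε', hε', le_rfl⟩, γ', InvSemigroup.mem_inv.2 hε', h2⟩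

theorem actIdeal_congr {s t : InvSemigroup C} {F G : Order.Ideal (Mor C)} (hs : s = t)
    (hF : F = G) (h : InDom s F) : actIdeal s F h = actIdeal t G (hs ▸ hF ▸ h) := by
  subst hs; subst hF; rfl

theorem actIdeal_mono {s : InvSemigroup C} {F G : Order.Ideal (Mor C)} (hle : F ≤ G)
    (h : InDom s F) (h' : InDom s G) : actIdeal s F h ≤ actIdeal s G h' := by
  rintro δ ⟨γ, hγ, r⟩
  exact ⟨γ, hle hγ, r⟩

theorem InDom.mono {s : InvSemigroup C} {F G : Order.Ideal (Mor C)} (h : InDom s F)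
    (hle : F ≤ G) : InDom s G := by
  obtain ⟨γ, hγ, r⟩ := h
  exact ⟨γ, hle hγ, r⟩

theorem isMax_actIdeal {s : InvSemigroup C} {D : Order.Ideal (Mor C)} (h : InDom s D)
    (hD : IsMax D) : IsMax (actIdeal s D h) := by
  intro E hE
  have h1 : InDom s⁻¹ E := (inDom_inv h).mono hE
  have h2 : D ≤ actIdeal s⁻¹ E h1 := by
    have := actIdeal_mono hE (inDom_inv h) h1
    rwa [actIdeal_inv] at this
  have h3 : actIdeal s⁻¹ E h1 ≤ D := hD h2
  have h4 := actIdeal_mono (s := s⁻¹⁻¹) h3 (inDom_inv h1)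
    (by rw [InvSemigroup.inv_inv']; exact h)
  rw [actIdeal_inv] at h4
  rwa [actIdeal_congr (InvSemigroup.inv_inv' s) rfl] at h4

theorem isTight_actIdeal [FinitelyAligned C] {s : InvSemigroup C} {F : Order.Ideal (Mor C)}
    (h : InDom s F) (hF : IsTight F) : IsTight (actIdeal s F h) := by
  rintro α ⟨γ, hγ, ε, hε, hα⟩ X hX hdisj
  choose Γ hΓ hΓ' using fun φ : Mor C => FinitelyAligned.aligned ε φ
  -- membership of `φ` in `s · D` only depends on a finite set of elements above `γ`
  have key : ∀ (D : Order.Ideal (Mor C)) (hD : InDom s D), γ ∈ D → ∀ φ,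
      (φ ∈ actIdeal s D hD ↔ ∃ η ∈ D, ∃ ζ ∈ Γ φ, ζ ∈ s.map η) := by
    intro D hD hγD φ
    constructor
    · rintro ⟨γ₁, hγ₁, ε₁, hε₁, hle⟩
      obtain ⟨γ₂, hγ₂, h1, h2⟩ := D.directed γ hγD γ₁ hγ₁
      obtain ⟨ε₂, hε₂, h3⟩ := s.lift_le h1 hε
      obtain ⟨ε₂', hε₂', h4⟩ := s.lift_le h2 hε₁
      obtain rfl := Option.mem_unique hε₂ hε₂'
      have hmem : ε₂ ∈ Set.Ici ε ∩ Set.Ici φ := ⟨h3, hle.trans h4⟩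
      rw [hΓ'] at hmem
      obtain ⟨ζ, hζ, hle'⟩ := Set.mem_iUnion₂.1 hmem
      have hζ' : ζ ∈ Set.Ici ε ∩ Set.Ici φ := by
        rw [hΓ']; exact Set.mem_iUnion₂.2 ⟨ζ, hζ, Set.mem_Ici.2 le_rfl⟩
      obtain ⟨η, hη, -⟩ := s.lift_le_inv hζ'.1 hε
      exact ⟨η, D.lower (s.le_of_le hle' hη hε₂) hγ₂, ζ, hζ, hη⟩
    · rintro ⟨η, hη, ζ, hζ, hζη⟩
      have hζ' : ζ ∈ Set.Ici ε ∩ Set.Ici φ := by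
        rw [hΓ']; exact Set.mem_iUnion₂.2 ⟨ζ, hζ, Set.mem_Ici.2 le_rfl⟩
      exact ⟨η, hη, ζ, hζη, hζ'.2⟩
  let Y : Set (Mor C) := {η | ∃ φ ∈ X, ∃ ζ ∈ Γ φ, ζ ∈ s.map η}
  have hY : Y.Finite := by
    have hfin : (⋃ φ ∈ X, Γ φ).Finite := hX.biUnion fun φ _ => hΓ φ
    have : Y = ⋃ ζ ∈ ⋃ φ ∈ X, Γ φ, {η | ζ ∈ s.map η} := by
      ext η
      simp only [Y, Set.mem_ofPred_eq, Set.mem_iUnion, exists_prop]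
      tauto
    rw [this]
    refine hfin.biUnion fun ζ _ => Set.Subsingleton.finite ?_
    intro η hη η' hη'
    exact s.map.inj hη hη'
  obtain ⟨D, hD, hγD, hDY⟩ := hF γ hγ Y hY (by
    rw [Set.disjoint_left]
    rintro η hη ⟨φ, hφ, ζ, hζ, hζη⟩
    exact Set.disjoint_left.1 hdisj ((key F h hγ φ).2 ⟨η, hη, ζ, hζ, hζη⟩) hφ)
  have hdom : InDom s D := ⟨γ, hγD, ε, hε⟩
  refine ⟨actIdeal s D hdom, isMax_actIdeal hdom hD, ⟨γ, hγD, ε, hε, hα⟩, ?_⟩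
  rw [Set.disjoint_left]
  intro φ hφ hφX
  obtain ⟨η, hη, ζ, hζ, hζη⟩ := (key D hdom hγD φ).1 hφ
  exact Set.disjoint_left.1 hDY hη ⟨φ, hφX, ζ, hζ, hζη⟩

end Action

/-! ## The tight groupoid -/

section TightGroupoid

/-- The pairs `(s, F)` with `F ∈ Λ_tight` and `F ∩ dom(s) ≠ ∅`. -/
structure PreGerm (C : Type u) [Category.{v} C] [LeftCancellative C] where
  elt : InvSemigroup C
  base : TightSpace C
  inDom : InDom elt base.carrier

variable {C : Type u} [Category.{v} C] [LeftCancellative C]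

/-- `(s, F) ∼ (t, G)` if `F = G` and `se = te` for an idempotent `e` with `F ∩ dom(e) ≠ ∅`. -/
def GermRel (p q : PreGerm C) : Prop :=
  p.base = q.base ∧ ∃ e : InvSemigroup C, e * e = e ∧ InDom e p.base.carrier ∧
    p.elt * e = q.elt * e

theorem germRel_iff {p q : PreGerm C} : GermRel p q ↔ p.base = q.base ∧
    ∃ γ ∈ p.base.carrier, ∀ γ', γ ≤ γ' → p.elt.map γ' = q.elt.map γ' := by
  refine and_congr_right fun _ => ⟨?_, ?_⟩
  · rintro ⟨e, he, ⟨γ, hγ, δ, hδ⟩, heq⟩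
    refine ⟨γ, hγ, fun γ' hle => ?_⟩
    obtain ⟨δ', hδ', -⟩ := e.lift_le hle hδ
    obtain rfl := InvSemigroup.eq_of_idem he hδ'
    refine Option.ext fun ε => ?_
    have : ε ∈ (p.elt * e).map δ' ↔ ε ∈ (q.elt * e).map δ' := by rw [heq]
    rw [InvSemigroup.mem_mul, InvSemigroup.mem_mul] at this
    constructor
    · intro h
      obtain ⟨ζ, h1, h2⟩ := this.1 ⟨δ', hδ', h⟩
      rwa [Option.mem_unique h1 hδ'] at h2
    · intro h
      obtain ⟨ζ, h1, h2⟩ := this.2 ⟨δ', hδ', h⟩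
      rwa [Option.mem_unique h1 hδ'] at h2
  · rintro ⟨γ, hγ, heq⟩
    refine ⟨InvSemigroup.proj γ, InvSemigroup.proj_idem γ,
      ⟨γ, hγ, γ, InvSemigroup.mem_proj.2 ⟨rfl, le_rfl⟩⟩, ?_⟩
    refine InvSemigroup.ext fun δ => Option.ext fun ε => ?_
    change ε ∈ (p.elt * InvSemigroup.proj γ).map δ ↔ ε ∈ (q.elt * InvSemigroup.proj γ).map δ
    simp only [InvSemigroup.mem_mul, InvSemigroup.mem_proj]
    constructor
    · rintro ⟨δ, ⟨rfl, hle⟩, h⟩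
      exact ⟨δ, ⟨rfl, hle⟩, heq δ hle ▸ h⟩
    · rintro ⟨δ, ⟨rfl, hle⟩, h⟩
      exact ⟨δ, ⟨rfl, hle⟩, heq δ hle ▸ h⟩

instance germSetoid (C : Type u) [Category.{v} C] [LeftCancellative C] :
    Setoid (PreGerm C) where
  r := GermRel
  iseqv :=
    { refl := fun p => germRel_iff.2 ⟨rfl, by
        obtain ⟨γ, hγ⟩ := p.base.carrier.nonempty
        exact ⟨γ, hγ, fun _ _ => rfl⟩⟩
      symm := fun {p q} h => by
        rw [germRel_iff] at h ⊢
        obtain ⟨h1, γ, hγ, h2⟩ := h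
        exact ⟨h1.symm, γ, h1 ▸ hγ, fun γ' hle => (h2 γ' hle).symm⟩
      trans := fun {p q t} h h' => by
        rw [germRel_iff] at h h' ⊢
        obtain ⟨h1, γ, hγ, h2⟩ := h
        obtain ⟨h1', γ', hγ', h2'⟩ := h'
        rw [← h1] at hγ'
        obtain ⟨δ, hδ, hle, hle'⟩ := p.base.carrier.directed γ hγ γ' hγ'
        exact ⟨h1.trans h1', δ, hδ, fun ε hε =>
          (h2 ε (hle.trans hε)).trans (h2' ε (hle'.trans hε))⟩ }

/-- The tight groupoid `𝒢_tight(Λ)` (its set of arrows): the set of germs `[s, F]`. Its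
groupoid structure, with unit space `Λ_tight`, is given further below. -/
def TightGroupoid (C : Type u) [Category.{v} C] [LeftCancellative C] [FinitelyAligned C] :
    Type (max u v) :=
  _root_.Quotient (germSetoid C)

namespace TightGroupoid

variable [FinitelyAligned C]

/-- The germ `[s, F]`. -/
def mk (s : InvSemigroup C) (F : TightSpace C) (h : InDom s F.carrier) : TightGroupoid C :=
  _root_.Quotient.mk (germSetoid C) ⟨s, F, h⟩

/-- The set `Θ(s, U)` of the germs `[s, F]` with `F ∈ U ∩ dom(s)`. -/
def Theta (s : InvSemigroup C) (U : Set (TightSpace C)) : Set (TightGroupoid C) :=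
  {x | ∃ (F : TightSpace C) (h : InDom s F.carrier), F ∈ U ∧ x = mk s F h}

/-- The topology of the tight groupoid, generated by the sets `Θ(s, U)` with `U` open. -/
instance : TopologicalSpace (TightGroupoid C) :=
  TopologicalSpace.generateFrom
    {V | ∃ (s : InvSemigroup C) (U : Set (TightSpace C)), IsOpen U ∧ V = Theta s U}

theorem mk_eq_mk {s t : InvSemigroup C} {F G : TightSpace C} {h : InDom s F.carrier}
    {h' : InDom t G.carrier} : mk s F h = mk t G h' ↔ F = G ∧
      ∃ γ ∈ F.carrier, ∀ γ', γ ≤ γ' → s.map γ' = t.map γ' := by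
  exact (_root_.Quotient.eq (r := germSetoid C)).trans germRel_iff

theorem exists_mk (x : TightGroupoid C) :
    ∃ (s : InvSemigroup C) (F : TightSpace C) (h : InDom s F.carrier), x = mk s F h := by
  induction x using _root_.Quotient.ind with
  | _ p => exact ⟨p.elt, p.base, p.inDom, rfl⟩

/-- `s · F` as a tight set. -/
def act (s : InvSemigroup C) (F : TightSpace C) (h : InDom s F.carrier) : TightSpace C :=
  ⟨actIdeal s F.carrier h, isTight_actIdeal h F.tight⟩

theorem act_eq {s t : InvSemigroup C} {F : TightSpace C} (hs : InDom s F.carrier)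
    (ht : InDom t F.carrier)
    (h : ∃ γ ∈ F.carrier, ∀ γ', γ ≤ γ' → s.map γ' = t.map γ') : act s F hs = act t F ht := by
  obtain ⟨γ, hγ, heq⟩ := h
  have aux : ∀ {s t : InvSemigroup C} (hs : InDom s F.carrier) (ht : InDom t F.carrier),
      (∀ γ', γ ≤ γ' → s.map γ' = t.map γ') →
      actIdeal s F.carrier hs ≤ actIdeal t F.carrier ht := by
    rintro s t hs ht heq δ ⟨η, hη, ε, hε, hle⟩
    obtain ⟨κ, hκ, h1, h2⟩ := F.carrier.directed γ hγ η hη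
    obtain ⟨ε', hε', h3⟩ := s.lift_le h2 hε
    exact ⟨κ, hκ, ε', heq κ h1 ▸ hε', hle.trans h3⟩
  exact tight_ext (le_antisymm (aux hs ht heq) (aux ht hs fun γ' h => (heq γ' h).symm))

theorem actIdeal_inv' {s : InvSemigroup C} {F : TightSpace C} (h : InDom s F.carrier) :
    act s⁻¹ (act s F h) (inDom_inv h) = F := tight_ext (actIdeal_inv h (inDom_inv h))

/-- The source `d([s, F]) = F`. -/
def source : TightGroupoid C → TightSpace C :=
  _root_.Quotient.lift (fun p => p.base) fun _ _ h => h.1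

/-- The range `r([s, F]) = s · F`. -/
def range : TightGroupoid C → TightSpace C :=
  _root_.Quotient.lift (fun p => act p.elt p.base p.inDom) fun p q h => by
    obtain ⟨h1, h2⟩ := germRel_iff.1 h
    obtain ⟨s, F, hs⟩ := p; obtain ⟨t, G, ht⟩ := q
    obtain rfl : F = G := h1
    exact act_eq _ _ h2

theorem inDom_mul {s t : InvSemigroup C} {G : TightSpace C} (ht : InDom t G.carrier)
    (hs : InDom s (act t G ht).carrier) : InDom (s * t) G.carrier := by
  obtain ⟨ζ, ⟨γ, hγ, ε, hε, hle⟩, δ, hδ⟩ := hs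
  obtain ⟨δ', hδ', -⟩ := s.lift_le hle hδ
  exact ⟨γ, hγ, δ', InvSemigroup.mem_mul.2 ⟨ε, hε, hδ'⟩⟩

theorem act_mul {s t : InvSemigroup C} {G : TightSpace C} (ht : InDom t G.carrier)
    (hs : InDom s (act t G ht).carrier) :
    act (s * t) G (inDom_mul ht hs) = act s (act t G ht) hs := by
  refine tight_ext (SetLike.ext fun δ => ⟨?_, ?_⟩)
  · rintro ⟨γ, hγ, ε, hε, hle⟩
    obtain ⟨ζ, h1, h2⟩ := InvSemigroup.mem_mul.1 hε
    exact ⟨ζ, ⟨γ, hγ, ζ, h1, le_rfl⟩, ε, h2, hle⟩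
  · rintro ⟨ζ, ⟨γ, hγ, η, hη, h1⟩, ε, hε, hle⟩
    obtain ⟨ε', hε', h2⟩ := s.lift_le h1 hε
    exact ⟨γ, hγ, ε', InvSemigroup.mem_mul.2 ⟨η, hη, hε'⟩, hle.trans h2⟩

/-- The product `[s, t·G][t, G] = [st, G]`, defined on representatives; it does not depend on
them by `mul_mk`. -/
noncomputable def mul (x y : TightGroupoid C) (h : x.source = y.range) : TightGroupoid C :=
  mk (x.out.elt * y.out.elt) y.out.base (inDom_mul y.out.inDom (by
    have hx : x.source = x.out.base := congrArg source (_root_.Quotient.out_eq x).symm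
    have hy : y.range = act y.out.elt y.out.base y.out.inDom :=
      congrArg range (_root_.Quotient.out_eq y).symm
    rw [← hy, ← h, hx]
    exact x.out.inDom))

theorem mul_mk {s t : InvSemigroup C} {F G : TightSpace C} (hs : InDom s F.carrier)
    (ht : InDom t G.carrier) (h : (mk s F hs).source = (mk t G ht).range) :
    mul (mk s F hs) (mk t G ht) h =
      mk (s * t) G (inDom_mul ht (by have h' : F = act t G ht := h; rwa [← h'])) := by
  have hx : GermRel (_root_.Quotient.out (mk s F hs)) ⟨s, F, hs⟩ :=
    _root_.Quotient.mk_out (s := germSetoid C) _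
  have hy : GermRel (_root_.Quotient.out (mk t G ht)) ⟨t, G, ht⟩ :=
    _root_.Quotient.mk_out (s := germSetoid C) _
  unfold mul
  rw [mk_eq_mk]
  rw [germRel_iff] at hx hy
  obtain ⟨h1, γ, hγ, hst⟩ := hx
  obtain ⟨h2, κ, hκ, htt⟩ := hy
  refine ⟨h2, ?_⟩
  have hF : F = act t G ht := h
  rw [h1] at hγ
  replace hγ : γ ∈ F.carrier := hγ
  rw [hF] at hγ
  obtain ⟨η, hη, ε, hε, hle⟩ := hγ
  rw [h2] at hκ ⊢
  obtain ⟨ρ, hρ, hle1, hle2⟩ := G.carrier.directed κ hκ η hη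
  refine ⟨ρ, hρ, fun γ' hγ' => ?_⟩
  obtain ⟨ε', hε', hle3⟩ := t.lift_le (hle2.trans hγ') hε
  have e1 := htt γ' (hle1.trans hγ')
  refine Option.ext fun δ => ?_
  rw [← Option.mem_def, ← Option.mem_def, InvSemigroup.mem_mul, InvSemigroup.mem_mul, e1]
  refine exists_congr fun ζ => and_congr_right fun hζ => ?_
  obtain rfl := Option.mem_unique hε' hζ
  rw [hst _ (hle.trans hle3)]

/-- The inverse `[s, F]⁻¹ = [s*, s·F]`. -/
def inv : TightGroupoid C → TightGroupoid C :=
  _root_.Quotient.lift (fun p => mk p.elt⁻¹ (act p.elt p.base p.inDom) (inDom_inv p.inDom))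
    fun p q h => by
      obtain ⟨h1, h2⟩ := germRel_iff.1 h
      obtain ⟨s, F, hs⟩ := p; obtain ⟨t, G, ht⟩ := q
      obtain rfl : F = G := h1
      refine mk_eq_mk.2 ⟨act_eq _ _ h2, ?_⟩
      obtain ⟨γ, hγ, heq⟩ := h2
      change γ ∈ F.carrier at hγ
      change ∀ γ', γ ≤ γ' → s.map γ' = t.map γ' at heq
      change InDom s F.carrier at hs
      obtain ⟨η, hη, ε, hε⟩ := hs
      obtain ⟨κ, hκ, h1, h2⟩ := F.carrier.directed γ hγ η hη
      obtain ⟨ε', hε', -⟩ := s.lift_le h2 hε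
      have hε'' : ε' ∈ t.map κ := heq κ h1 ▸ hε'
      refine ⟨ε', ⟨κ, hκ, ε', hε', le_rfl⟩, fun ζ hζ => ?_⟩
      refine Option.ext fun δ => ?_
      change δ ∈ s⁻¹.map ζ ↔ δ ∈ t⁻¹.map ζ
      rw [InvSemigroup.mem_inv, InvSemigroup.mem_inv]
      constructor
      · intro hδ
        exact heq δ (h1.trans (s.le_of_le hζ hε' hδ)) ▸ hδ
      · intro hδ
        exact heq δ (h1.trans (t.le_of_le hζ hε'' hδ)) ▸ hδ

/-- The unit `[τ^γ σ^γ, F]` at `F`, for any `γ ∈ F`. -/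
noncomputable def unit (F : TightSpace C) : TightGroupoid C :=
  mk (.proj F.carrier.nonempty.some) F (inDom_proj F.carrier.nonempty.some_mem)

theorem mk_eq_unit {s : InvSemigroup C} {F : TightSpace C} {h : InDom s F.carrier} :
    mk s F h = unit F ↔ ∃ γ ∈ F.carrier, γ ∈ s.map γ := by
  have hm := F.carrier.nonempty.some_mem
  unfold unit
  rw [mk_eq_mk]
  generalize F.carrier.nonempty.some = κ at hm
  constructor
  · rintro ⟨-, γ, hγ, heq⟩
    obtain ⟨ρ, hρ, h1, h2⟩ := F.carrier.directed γ hγ κ hm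
    exact ⟨ρ, hρ, heq ρ h1 ▸ InvSemigroup.mem_proj.2 ⟨rfl, h2⟩⟩
  · rintro ⟨γ, hγ, hs⟩
    obtain ⟨ρ, hρ, h1, h2⟩ := F.carrier.directed γ hγ κ hm
    refine ⟨rfl, ρ, hρ, fun γ' hle => ?_⟩
    have : γ' ∈ s.map γ' := by
      obtain ⟨η, hη⟩ := h1.trans hle
      obtain ⟨hη1, hη2⟩ := hη
      subst hη2
      have heq : ∀ (s : Mor C ≃. Mor C), IsGenerated s → ∀ (γ δ : Mor C), δ ∈ s γ →
          ∀ (hη : γ.src = η.tgt), ∃ h' : δ.src = η.tgt, δ.comp η h' ∈ s (γ.comp η hη) := by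
        intro s hs
        induction hs with
        | shift α =>
          intro γ δ hδ hη
          obtain ⟨h1, rfl⟩ := mem_shift.1 hδ
          exact ⟨hη, mem_shift.2 ⟨h1, (Mor.comp_assoc _ _ _ _ _).symm⟩⟩
        | prepend α =>
          intro γ δ hδ hη
          obtain ⟨h1, rfl⟩ := mem_prepend.1 hδ
          exact ⟨hη, mem_prepend.2 ⟨h1, (Mor.comp_assoc _ _ _ _ _).symm⟩⟩
        | comp _ _ hs ht =>
          intro γ δ hδ hη
          obtain ⟨ε, h1, h2⟩ := (PEquiv.mem_trans _ _ _ _).1 hδ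
          obtain ⟨h3, h4⟩ := ht _ _ h1 hη
          obtain ⟨h5, h6⟩ := hs _ _ h2 h3
          exact ⟨h5, (PEquiv.mem_trans _ _ _ _).2 ⟨_, h4, h6⟩⟩
      exact (heq s.map s.gen γ γ hs hη1).2
    have h' : γ' ∈ (InvSemigroup.proj κ).map γ' :=
      InvSemigroup.mem_proj.2 ⟨rfl, h2.trans hle⟩
    exact (Option.mem_def.1 this).trans (Option.mem_def.1 h').symm

theorem unit_range (F : TightSpace C) : (unit F).range = F := by
  refine tight_ext (SetLike.ext fun δ => ⟨?_, fun hδ => ?_⟩)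
  · rintro ⟨γ, hγ, ε, hε, hle⟩
    obtain ⟨rfl, -⟩ := InvSemigroup.mem_proj.1 hε
    exact F.carrier.lower hle hγ
  · obtain ⟨κ, hκ, h1, h2⟩ := F.carrier.directed _ F.carrier.nonempty.some_mem δ hδ
    exact ⟨κ, hκ, κ, InvSemigroup.mem_proj.2 ⟨rfl, h1⟩, h2⟩

theorem source_mul (x y : TightGroupoid C) (h : x.source = y.range) :
    (mul x y h).source = y.source := by
  obtain ⟨s, F, hs, rfl⟩ := exists_mk x
  obtain ⟨t, G, ht, rfl⟩ := exists_mk y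
  rw [mul_mk]; rfl

theorem range_mul (x y : TightGroupoid C) (h : x.source = y.range) :
    (mul x y h).range = x.range := by
  obtain ⟨s, F, hs, rfl⟩ := exists_mk x
  obtain ⟨t, G, ht, rfl⟩ := exists_mk y
  rw [mul_mk]
  obtain rfl : F = act t G ht := h
  exact act_mul ht hs

theorem mul_unit (x : TightGroupoid C) (F : TightSpace C) (h : x.source = (unit F).range) :
    mul x (unit F) h = x := by
  obtain ⟨s, F', hs, rfl⟩ := exists_mk x
  obtain rfl : F' = F := h.trans (unit_range F)
  refine (mul_mk hs (inDom_proj F'.carrier.nonempty.some_mem) h).trans (mk_eq_mk.2 ?_)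
  refine ⟨rfl, _, F'.carrier.nonempty.some_mem, fun γ' hle => Option.ext fun δ => ?_⟩
  rw [← Option.mem_def, ← Option.mem_def, InvSemigroup.mem_mul]
  simp only [InvSemigroup.mem_proj]
  constructor
  · rintro ⟨_, ⟨rfl, _⟩, h⟩
    exact h
  · exact fun h => ⟨_, ⟨rfl, hle⟩, h⟩

theorem unit_mul (x : TightGroupoid C) (F : TightSpace C) (h : (unit F).source = x.range) :
    mul (unit F) x h = x := by
  obtain ⟨s, F', hs, rfl⟩ := exists_mk x
  obtain rfl : F = act s F' hs := h
  have hm := (act s F' hs).carrier.nonempty.some_mem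
  refine (mul_mk (inDom_proj hm) hs rfl).trans (mk_eq_mk.2 ⟨rfl, ?_⟩)
  generalize (act s F' hs).carrier.nonempty.some = κ at hm
  obtain ⟨γ, hγ, ε, hε, hle⟩ := hm
  refine ⟨γ, hγ, fun γ' hle' => Option.ext fun δ => ?_⟩
  obtain ⟨ε', hε', hle''⟩ := s.lift_le hle' hε
  rw [← Option.mem_def, ← Option.mem_def, InvSemigroup.mem_mul]
  simp only [InvSemigroup.mem_proj]
  constructor
  · rintro ⟨_, h, rfl, _⟩
    exact h
  · intro h
    obtain rfl := Option.mem_unique hε' h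
    exact ⟨_, h, rfl, hle.trans hle''⟩

theorem mul_assoc' (x y z : TightGroupoid C) (h : x.source = y.range) (h' : y.source = z.range) :
    mul (mul x y h) z ((source_mul x y h).trans h') =
      mul x (mul y z h') (h.trans (range_mul y z h').symm) := by
  obtain ⟨s, F, hs, rfl⟩ := exists_mk x
  obtain ⟨t, G, ht, rfl⟩ := exists_mk y
  obtain ⟨q, H, hq, rfl⟩ := exists_mk z
  simp only [mul_mk, InvSemigroup.mul_assoc']

theorem source_inv (x : TightGroupoid C) : x.inv.source = x.range := by
  obtain ⟨s, F, hs, rfl⟩ := exists_mk x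
  rfl

theorem range_inv (x : TightGroupoid C) : x.inv.range = x.source := by
  obtain ⟨s, F, hs, rfl⟩ := exists_mk x
  exact actIdeal_inv' hs

theorem mul_inv (x : TightGroupoid C) (h : x.source = x.inv.range) :
    mul x x.inv h = unit x.range := by
  obtain ⟨s, F, hs, rfl⟩ := exists_mk x
  refine (mul_mk (t := s⁻¹) (G := act s F hs) hs (inDom_inv hs) h).trans
    (mk_eq_unit.2 ?_)
  obtain ⟨γ, hγ, ε, hε⟩ := hs
  exact ⟨ε, ⟨γ, hγ, ε, hε, le_rfl⟩, InvSemigroup.mem_mul.2 ⟨γ, InvSemigroup.mem_inv.2 hε, hε⟩⟩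

theorem inv_mul (x : TightGroupoid C) (h : x.inv.source = x.range) :
    mul x.inv x h = unit x.source := by
  obtain ⟨s, F, hs, rfl⟩ := exists_mk x
  refine (mul_mk (s := s⁻¹) (F := act s F hs) (inDom_inv hs) hs h).trans
    (mk_eq_unit.2 ?_)
  obtain ⟨γ, hγ, ε, hε⟩ := hs
  exact ⟨γ, hγ, InvSemigroup.mem_mul.2 ⟨ε, hε, InvSemigroup.mem_inv.2 hε⟩⟩

end TightGroupoid

open TightGroupoid in
/-- The tight groupoid as a category with set of objects `Λ_tight`; the arrows from `F` to `G`
are the germs with source `F` and range `G`. -/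
noncomputable instance [FinitelyAligned C] : Groupoid (TightSpace C) where
  Hom F G := {x : TightGroupoid C // x.source = F ∧ x.range = G}
  id F := ⟨unit F, rfl, unit_range F⟩
  comp y x := ⟨mul x.1 y.1 (x.2.1.trans y.2.2.symm),
    (source_mul _ _ _).trans y.2.1, (range_mul _ _ _).trans x.2.2⟩
  id_comp {F _} x := Subtype.ext (mul_unit x.1 F (x.2.1.trans (unit_range F).symm))
  comp_id {_ G} x := Subtype.ext (unit_mul x.1 G x.2.2.symm)
  assoc z y x := Subtype.ext
    (mul_assoc' x.1 y.1 z.1 (x.2.1.trans y.2.2.symm) (y.2.1.trans z.2.2.symm)).symm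
  inv x := ⟨x.1.inv, (source_inv _).trans x.2.2, (range_inv _).trans x.2.1⟩
  inv_comp x := Subtype.ext ((mul_inv x.1 (range_inv _).symm).trans
    (congrArg unit x.2.2))
  comp_inv x := Subtype.ext ((inv_mul x.1 (source_inv _)).trans (congrArg unit x.2.1))

end TightGroupoid

/-! ## Length functions, partial isomorphisms, groupoid actions -/

/-- A length function `d : Λ → Γ`, for a submonoid `Γ` of a group. -/
structure LengthFunction (C : Type u) [Category.{v} C] {Q : Type w} [Group Q]
    (Γ : Submonoid Q) where
  toFun : Mor C → Γ
  map_comp : ∀ (α β : Mor C) (h : α.src = β.tgt), toFun (α.comp β h) = toFun α * toFun β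

/-- The set `xΛ` of the morphisms with range `x`. -/
abbrev Into {C : Type u} [Category.{v} C] (x : C) : Type (max u v) := {α : Mor C // α.tgt = x}

section Actions

variable {C : Type u} [Category.{v} C] {Q : Type w} [Group Q] {Γ : Submonoid Q}

/-- The elements of `PIso(Λ, d)` with domain `x` and codomain `y`: bijections `f : xΛ → yΛ` with
`f(αΛ) = f(α)Λ`, `f(x) = y` and `d(f(α)) = d(α)`. -/
@[ext] structure PIso (d : LengthFunction C Γ) (x y : C) where
  toEquiv : Into x ≃ Into y
  image_ideal : ∀ α : Into x, toEquiv '' {β | α.1 ≤ β.1} = {β | (toEquiv α).1 ≤ β.1}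
  map_id : toEquiv ⟨Mor.id x, rfl⟩ = ⟨Mor.id y, rfl⟩
  map_length : ∀ α : Into x, d.toFun (toEquiv α).1 = d.toFun α.1

/-- The objects of the groupoid `PIso(Λ, d)`: those of `Λ`. -/
structure PIsoObj (d : LengthFunction C Γ) where
  obj : C

/-- The groupoid `PIso(Λ, d)`, under composition of maps. -/
instance (d : LengthFunction C Γ) : Groupoid (PIsoObj d) where
  Hom x y := PIso d x.obj y.obj
  id x := ⟨Equiv.refl _, fun α => by simp, rfl, fun _ => rfl⟩
  comp f g := ⟨f.toEquiv.trans g.toEquiv, fun α => by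
      rw [Equiv.coe_trans, Set.image_comp, f.image_ideal, g.image_ideal]; rfl,
    by rw [Equiv.trans_apply, f.map_id, g.map_id],
    fun α => by rw [Equiv.trans_apply, g.map_length, f.map_length]⟩
  id_comp _ := rfl
  comp_id _ := rfl
  assoc _ _ _ := rfl
  inv f := ⟨f.toEquiv.symm, fun α => by
      have h := f.image_ideal (f.toEquiv.symm α)
      rw [Equiv.apply_symm_apply] at h
      rw [← h, Equiv.symm_image_image],
    by rw [← f.map_id, Equiv.symm_apply_apply],
    fun α => by rw [← f.map_length, Equiv.apply_symm_apply]⟩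
  inv_comp f := by
    apply PIso.ext
    exact Equiv.symm_trans_self f.toEquiv
  comp_inv f := by
    apply PIso.ext
    exact Equiv.self_trans_symm f.toEquiv

/-- An action of the discrete groupoid `𝒢` on `Λ`: a groupoid homomorphism
`φ : 𝒢 → PIso(Λ, d)` whose restriction to the unit spaces is a bijection. -/
structure GroupoidAction (d : LengthFunction C Γ) (G : Type u') [Groupoid.{v'} G] where
  functor : G ⥤ PIsoObj d
  bijective : Function.Bijective functor.obj

namespace GroupoidAction

variable {d : LengthFunction C Γ} {G : Type u'} [Groupoid.{v'} G] (A : GroupoidAction d G)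

/-- The bijection `𝒢⁽⁰⁾ → Λ⁰`. -/
def base (a : G) : C := (A.functor.obj a).obj

theorem base_bijective : Function.Bijective A.base := by
  constructor
  · intro a b h
    apply A.bijective.1
    change (A.functor.obj a).obj = (A.functor.obj b).obj at h
    cases ha : A.functor.obj a; cases hb : A.functor.obj b
    simp_all
  · intro x
    obtain ⟨a, ha⟩ := A.bijective.2 ⟨x⟩
    exact ⟨a, by simp [base, ha]⟩

/-- The unit of `𝒢` that is identified with `x ∈ Λ⁰`. -/
noncomputable def unit (x : C) : Mor G :=
  Mor.id ((Equiv.ofBijective A.base A.base_bijective).symm x)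

theorem base_unit (x : C) : A.base (A.unit x).src = x :=
  Equiv.ofBijective_apply_symm_apply A.base A.base_bijective x

theorem base_unit' (x : C) : A.base (A.unit x).tgt = x := A.base_unit x

theorem unit_base (a : G) : A.unit (A.base a) = Mor.id a := by
  have : (Equiv.ofBijective A.base A.base_bijective).symm (A.base a) = a :=
    Equiv.ofBijective_symm_apply_apply A.base A.base_bijective a
  rw [unit, this]

/-- `g · α = φ(g)(α)`, defined when `s(g) = r(α)`. -/
def act (g : Mor G) (α : Mor C) (h : A.base g.src = α.tgt) : Mor C :=
  (PIso.toEquiv (A.functor.map g.hom) ⟨α, h.symm⟩).1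

theorem act_tgt (g : Mor G) (α : Mor C) (h : A.base g.src = α.tgt) :
    (A.act g α h).tgt = A.base g.tgt :=
  (PIso.toEquiv (A.functor.map g.hom) ⟨α, h.symm⟩).2

theorem act_congr {g g' : Mor G} {α α' : Mor C} (hg : g = g') (hα : α = α')
    (h : A.base g.src = α.tgt) : A.act g α h = A.act g' α' (hg ▸ hα ▸ h) := by
  subst hg; subst hα; rfl

theorem act_comp (g k : Mor G) (α : Mor C) (hgk : g.src = k.tgt) (h : A.base k.src = α.tgt) :
    A.act (g.comp k hgk) α h =
      A.act g (A.act k α h) (by rw [hgk, A.act_tgt]) := by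
  obtain ⟨g⟩ := g; obtain ⟨k⟩ := k
  cases hgk
  have : (Mor.comp (Mor.mk g) (Mor.mk k) rfl) = Mor.mk (k ≫ g) := by simp [Mor.comp]
  rw [A.act_congr this rfl]
  unfold act
  simp only [Functor.map_comp]
  rfl

theorem act_one (a : G) (α : Mor C) (h : A.base a = α.tgt) : A.act (Mor.id a) α h = α := by
  unfold act
  have : A.functor.map (Mor.id a).hom = 𝟙 (A.functor.obj a) := A.functor.map_id a
  simp only [this]
  rfl

theorem act_id (g : Mor G) : A.act g (Mor.id (A.base g.src)) rfl = Mor.id (A.base g.tgt) :=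
  congrArg Subtype.val (PIso.map_id (A.functor.map g.hom))

theorem act_injective {g : Mor G} {α β : Mor C} (h : A.base g.src = α.tgt)
    (h' : A.base g.src = β.tgt) (heq : A.act g α h = A.act g β h') : α = β :=
  congrArg Subtype.val ((PIso.toEquiv (A.functor.map g.hom)).injective (Subtype.ext heq))

end GroupoidAction

/-! ## Category cocycles and the Zappa-Szép product -/

/-- A category cocycle `φ : 𝒢 ₛ×ᵣ Λ → 𝒢` for the action `A`; then `(Λ, d, 𝒢, φ)` is a category
system. The fields `base_src` and `base_tgt` say that `φ(g,α) · s(α)` is defined and that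
`s(g·α) = φ(g,α) · s(α) = r(φ(g,α))`. -/
structure CategoryCocycle {d : LengthFunction C Γ} {G : Type u'} [Groupoid.{v'} G]
    (A : GroupoidAction d G) where
  toFun : (g : Mor G) → (α : Mor C) → A.base g.src = α.tgt → Mor G
  base_src : ∀ g α h, A.base (toFun g α h).src = α.src
  base_tgt : ∀ g α h, A.base (toFun g α h).tgt = (A.act g α h).src
  /-- `φ(gk, α) = φ(g, k·α) φ(k, α)` -/
  cocycle : ∀ (g k : Mor G) (α : Mor C) (hgk : g.src = k.tgt) (h : A.base k.src = α.tgt),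
    toFun (g.comp k hgk) α h =
      (toFun g (A.act k α h) (by rw [hgk, A.act_tgt])).comp (toFun k α h)
        (A.base_bijective.1 (by rw [base_src, base_tgt]))
  /-- `φ(g, s(g)) = g` -/
  map_id : ∀ g : Mor G, toFun g (Mor.id (A.base g.src)) rfl = g
  /-- `φ(r(α), α) = s(α)` -/
  map_unit : ∀ α : Mor C, toFun (A.unit α.tgt) α (A.base_unit _) = A.unit α.src
  /-- `φ(g, αβ) = φ(φ(g, α), β)` -/
  map_comp : ∀ (g : Mor G) (α β : Mor C) (h : A.base g.src = α.tgt) (hαβ : α.src = β.tgt),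
    toFun g (α.comp β hαβ) h = toFun (toFun g α h) β (by rw [base_src, hαβ])
  /-- `g·(αβ) = (g·α)(φ(g, α)·β)` -/
  act_comp : ∀ (g : Mor G) (α β : Mor C) (h : A.base g.src = α.tgt) (hαβ : α.src = β.tgt),
    A.act g (α.comp β hαβ) h =
      (A.act g α h).comp (A.act (toFun g α h) β (by rw [base_src, hαβ]))
        (by rw [A.act_tgt, base_tgt])

variable {d : LengthFunction C Γ} {G : Type u'} [Groupoid.{v'} G] {A : GroupoidAction d G}

theorem CategoryCocycle.congr (φ : CategoryCocycle A) {g g' : Mor G} {α α' : Mor C}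
    (hg : g = g') (hα : α = α') (h : A.base g.src = α.tgt) :
    φ.toFun g α h = φ.toFun g' α' (hg ▸ hα ▸ h) := by
  subst hg; subst hα; rfl

/-- The objects of the Zappa-Szép product `Λ ⋈^φ 𝒢`: those of `Λ`. -/
structure ZappaSzep (φ : CategoryCocycle A) where
  obj : C

namespace ZappaSzep

variable {φ : CategoryCocycle A}

/-- The morphisms of `Λ ⋈^φ 𝒢` from `x` to `y`: the pairs `(α, g)` with `s(α) = r(g)`,
`r(α) = y` and `s(g) = x`. -/
@[ext] structure Hom (x y : ZappaSzep φ) where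
  fst : Mor C
  snd : Mor G
  compat : fst.src = A.base snd.tgt
  tgt_eq : fst.tgt = y.obj
  src_eq : A.base snd.src = x.obj

theorem Hom.act_ok {x y z : ZappaSzep φ} (p : Hom y z) (q : Hom x y) :
    A.base p.snd.src = q.fst.tgt := p.src_eq.trans q.tgt_eq.symm

theorem Hom.fst_ok {x y z : ZappaSzep φ} (p : Hom y z) (q : Hom x y) :
    p.fst.src = (A.act p.snd q.fst (p.act_ok q)).tgt := p.compat.trans (A.act_tgt _ _ _).symm

theorem Hom.snd_ok {x y z : ZappaSzep φ} (p : Hom y z) (q : Hom x y) :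
    (φ.toFun p.snd q.fst (p.act_ok q)).src = q.snd.tgt :=
  A.base_bijective.1 ((φ.base_src _ _ _).trans q.compat)

/-- The product `(α, g)(β, h) = (α (g·β), φ(g, β) h)`. -/
def Hom.mul {x y z : ZappaSzep φ} (p : Hom y z) (q : Hom x y) : Hom x z where
  fst := p.fst.comp (A.act p.snd q.fst (p.act_ok q)) (p.fst_ok q)
  snd := (φ.toFun p.snd q.fst (p.act_ok q)).comp q.snd (p.snd_ok q)
  compat := (φ.base_tgt _ _ _).symm
  tgt_eq := p.tgt_eq
  src_eq := q.src_eq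

theorem Hom.mul_assoc {x y z t : ZappaSzep φ} (p : Hom z t) (q : Hom y z) (k : Hom x y) :
    (p.mul q).mul k = p.mul (q.mul k) := by
  apply Hom.ext
  · refine (Mor.comp_assoc _ _ _ (p.fst_ok q) ((p.mul q).fst_ok k)).trans ?_
    have h1 : A.act (p.mul q).snd k.fst ((p.mul q).act_ok k) =
        A.act (φ.toFun p.snd q.fst (p.act_ok q)) (A.act q.snd k.fst (q.act_ok k)) _ :=
      A.act_comp _ _ _ (p.snd_ok q) (q.act_ok k)
    have h2 := φ.act_comp p.snd q.fst (A.act q.snd k.fst (q.act_ok k)) (p.act_ok q)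
      (q.fst_ok k)
    have h3 := Mor.comp_congr rfl h1 (α := A.act p.snd q.fst (p.act_ok q))
      ((p.mul q).fst_ok k)
    exact Mor.comp_congr rfl (h3.trans h2.symm) (p.fst_ok q)
  · have h1 := φ.cocycle (φ.toFun p.snd q.fst (p.act_ok q)) q.snd k.fst (p.snd_ok q)
      (q.act_ok k)
    have h2 := φ.map_comp p.snd q.fst (A.act q.snd k.fst (q.act_ok k)) (p.act_ok q)
      (q.fst_ok k)
    refine (Mor.comp_congr h1 rfl ((p.mul q).snd_ok k)).trans ?_
    refine (Mor.comp_assoc _ _ _ _ (q.snd_ok k)).trans ?_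
    exact (Mor.comp_congr h2 rfl (p.snd_ok (q.mul k))).symm

/-- The identity of `Λ ⋈^φ 𝒢` at `x`, the pair `(x, x)`. -/
noncomputable def Hom.id (x : ZappaSzep φ) : Hom x x :=
  ⟨Mor.id x.obj, A.unit x.obj, (A.base_unit' _).symm, rfl, A.base_unit _⟩

theorem Hom.mul_id {x y : ZappaSzep φ} (p : Hom x y) : p.mul (Hom.id x) = p := by
  apply Hom.ext
  · have h1 : A.act p.snd (Hom.id x).fst (p.act_ok (Hom.id x)) = Mor.id (A.base p.snd.tgt) :=
      (A.act_congr rfl (congrArg Mor.id p.src_eq.symm) p.src_eq).trans (A.act_id p.snd)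
    exact (Mor.comp_congr rfl h1 (p.fst_ok (Hom.id x))).trans (Mor.comp_id _ _ p.compat)
  · exact (Mor.comp_id _ _ (p.snd_ok (Hom.id x))).trans
      ((φ.congr rfl (congrArg Mor.id p.src_eq.symm) p.src_eq).trans (φ.map_id _))

theorem Hom.id_mul {x y : ZappaSzep φ} (p : Hom x y) : (Hom.id y).mul p = p := by
  apply Hom.ext
  · exact (Mor.id_comp _ _ ((Hom.id y).fst_ok p)).trans (A.act_one _ _ ((Hom.id y).act_ok p))
  · have h : φ.toFun (A.unit y.obj) p.fst ((A.base_unit _).trans p.tgt_eq.symm) =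
        Mor.id p.snd.tgt :=
      (φ.congr (congrArg A.unit p.tgt_eq.symm) rfl _).trans ((φ.map_unit p.fst).trans
        ((congrArg A.unit p.compat).trans (A.unit_base _)))
    exact (Mor.comp_congr h rfl ((Hom.id y).snd_ok p)).trans (Mor.id_comp _ _ rfl)

/-- The Zappa-Szép product `Λ ⋈^φ 𝒢` as a category. -/
noncomputable instance : Category (ZappaSzep φ) where
  Hom := Hom
  id := Hom.id
  comp q p := p.mul q
  id_comp p := p.mul_id
  comp_id p := p.id_mul
  assoc k q p := (Hom.mul_assoc p q k).symm

theorem hom_eq {x y : ZappaSzep φ} {p q : x ⟶ y} (h1 : Hom.fst p = Hom.fst q)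
    (h2 : Hom.snd p = Hom.snd q) : p = q := Hom.ext h1 h2

/-- The element `(α, g)` of `Λ ⋈^φ 𝒢`, for `s(α) = r(g)`. -/
def pair (φ : CategoryCocycle A) (α : Mor C) (g : Mor G) (h : α.src = A.base g.tgt) :
    Mor (ZappaSzep φ) :=
  ⟨(⟨α, g, h, rfl, rfl⟩ : Hom (φ := φ) ⟨A.base g.src⟩ ⟨α.tgt⟩)⟩

theorem pair_congr {α α' : Mor C} {g g' : Mor G} (hα : α = α') (hg : g = g')
    (h : α.src = A.base g.tgt) : pair φ α g h = pair φ α' g' (hα ▸ hg ▸ h) := by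
  subst hα; subst hg; rfl

theorem exists_pair (m : Mor (ZappaSzep φ)) : ∃ (α : Mor C) (g : Mor G)
    (h : α.src = A.base g.tgt), m = pair φ α g h := by
  obtain ⟨⟨α, g, h, h1, h2⟩⟩ := m
  rename_i x y
  obtain ⟨x⟩ := x; obtain ⟨y⟩ := y
  cases h1; cases h2
  exact ⟨α, g, h, rfl⟩

theorem pair_inj {α α' : Mor C} {g g' : Mor G} {h : α.src = A.base g.tgt}
    {h' : α'.src = A.base g'.tgt} (heq : pair φ α g h = pair φ α' g' h') : α = α' ∧ g = g' := by
  have h1 : ∀ {m m' : Mor (ZappaSzep φ)}, m = m' →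
      Hom.fst m.hom = Hom.fst m'.hom ∧ Hom.snd m.hom = Hom.snd m'.hom := by
    rintro m _ rfl; exact ⟨rfl, rfl⟩
  exact h1 heq

/-- The product formula `(α, g)(β, k) = (α (g·β), φ(g, β) k)` for elements of `Λ ⋈^φ 𝒢`. -/
theorem pair_comp {α β : Mor C} {g k : Mor G} (hα : α.src = A.base g.tgt)
    (hβ : β.src = A.base k.tgt) (hg : A.base g.src = β.tgt)
    (h : (pair φ α g hα).src = (pair φ β k hβ).tgt) :
    (pair φ α g hα).comp (pair φ β k hβ) h =
      pair φ (α.comp (A.act g β hg) (by rw [hα, A.act_tgt]))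
        ((φ.toFun g β hg).comp k (A.base_bijective.1 (by rw [φ.base_src, hβ])))
        (by rw [Mor.comp_src, Mor.comp_tgt, φ.base_tgt]) := by
  obtain ⟨β⟩ := β
  rename_i b c
  change A.base g.src = c at hg
  subst hg
  unfold pair Mor.comp
  simp only [eqToHom_refl, Category.id_comp]
  rfl

theorem src_pair {α : Mor C} {g : Mor G} {h : α.src = A.base g.tgt} :
    (pair φ α g h).src = ⟨A.base g.src⟩ := rfl

theorem tgt_pair {α : Mor C} {g : Mor G} {h : α.src = A.base g.tgt} :
    (pair φ α g h).tgt = ⟨α.tgt⟩ := rfl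

instance [LeftCancellative C] : LeftCancellative (ZappaSzep φ) where
  cancel a b c h h' heq := by
    obtain ⟨α, g, hα, rfl⟩ := exists_pair a
    obtain ⟨β, k, hβ, rfl⟩ := exists_pair b
    obtain ⟨γ, l, hγ, rfl⟩ := exists_pair c
    have h1 : A.base g.src = β.tgt := congrArg obj h
    have h2 : A.base g.src = γ.tgt := congrArg obj h'
    rw [pair_comp hα hβ h1, pair_comp hα hγ h2] at heq
    obtain ⟨e1, e2⟩ := pair_inj heq
    obtain rfl : β = γ := A.act_injective h1 h2 (LeftCancellative.cancel _ _ _ _ _ e1)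
    have gcancel : ∀ (p q q' : Mor G) (h : p.src = q.tgt) (h' : p.src = q'.tgt),
        p.comp q h = p.comp q' h' → q = q' := by
      rintro ⟨p⟩ ⟨q⟩ ⟨q'⟩ h h' heq
      cases h; cases h'
      simp only [Mor.comp, eqToHom_refl, Category.id_comp, Mor.mk.injEq, true_and] at heq
      obtain ⟨rfl, heq⟩ := heq
      have := congrArg (fun f => f ≫ Groupoid.inv p) (eq_of_heq heq)
      simpa using this
    exact pair_congr rfl (gcancel _ _ _ _ _ e2) _

theorem pair_le_pair {α β : Mor C} {g k : Mor G} {hα : α.src = A.base g.tgt}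
    {hβ : β.src = A.base k.tgt} : pair φ α g hα ≤ pair φ β k hβ ↔ α ≤ β := by
  constructor
  · rintro ⟨m, h, heq⟩
    obtain ⟨δ, l, hδ, rfl⟩ := exists_pair m
    have h1 : A.base g.src = δ.tgt := congrArg obj h
    rw [pair_comp hα hδ h1] at heq
    exact ⟨_, _, (pair_inj heq).1⟩
  · rintro ⟨ε, h, rfl⟩
    -- solve `g · δ = ε`
    obtain ⟨⟨δ, hδ⟩, hδ'⟩ := (PIso.toEquiv (A.functor.map g.hom)).surjective
      ⟨ε, (h.symm.trans hα : ε.tgt = A.base g.tgt)⟩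
    have hδ1 : A.base g.src = δ.tgt := hδ.symm
    have hδ2 : A.act g δ hδ1 = ε := congrArg Subtype.val hδ'
    -- solve `φ(g, δ) l = k`
    have htgt : (φ.toFun g δ hδ1).tgt = k.tgt := A.base_bijective.1 (by
      rw [φ.base_tgt, hδ2]; exact hβ)
    obtain ⟨l, hl, hl'⟩ : ∃ (l : Mor G) (hl : (φ.toFun g δ hδ1).src = l.tgt),
        (φ.toFun g δ hδ1).comp l hl = k := by
      generalize φ.toFun g δ hδ1 = p at htgt
      obtain ⟨p⟩ := p; obtain ⟨k⟩ := k
      cases htgt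
      refine ⟨⟨k ≫ Groupoid.inv p⟩, rfl, ?_⟩
      simp [Mor.comp]
    have hδl : δ.src = A.base l.tgt := by rw [← hl, φ.base_src]
    refine ⟨pair φ δ l hδl, ?_, ?_⟩
    · rw [src_pair, tgt_pair, hδ1]
    · rw [pair_comp hα hδl hδ1]
      exact pair_congr (Mor.comp_congr rfl hδ2.symm _) hl'.symm _

instance [FinitelyAligned C] : FinitelyAligned (ZappaSzep φ) where
  aligned a b := by
    obtain ⟨α, g, hα, rfl⟩ := exists_pair a
    obtain ⟨β, k, hβ, rfl⟩ := exists_pair b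
    obtain ⟨X, hX, heq⟩ := FinitelyAligned.aligned α β
    refine ⟨(fun γ => pair φ γ (A.unit γ.src) (A.base_unit' _).symm) '' X, hX.image _, ?_⟩
    ext m
    obtain ⟨ε, l, hε, rfl⟩ := exists_pair m
    have h := Set.ext_iff.1 heq ε
    simpa [pair_le_pair] using h

end ZappaSzep

end Actions

end LCSC

open LCSC

/-! The argument splits into a criterion for an arbitrary finitely aligned left cancellative
category and a computation in the Zappa-Szép product.

The general criterion is `TightGroupoid.t2Space_iff`: the tight groupoid is Hausdorff iff for all
`a`, `b` with a common source the equalizer `{δ : aδ = bδ}` has a finite subset `H` that each of its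
elements meets. It rests on the fact that an element `s` of the inverse semigroup satisfies `s(γζ) =
s(γ)ζ`, so two germs `[s, F]` and `[t, F]` agree exactly when `F` contains some `γζ` with `s(γ)ζ =
t(γ)ζ`. If no finite `H` works, each finite subset `H` of the equalizer is missed by some `δ_H` in
the equalizer. Maximal sets `D_H` containing `δ_H` converge along an ultrafilter to a tight `F`, and
the germs `[τ^a, D_H] = [τ^b, D_H]` converge to both `[τ^a, F]` and `[τ^b, F]`. These limits differ:
an `η` in `F` and in the equalizer would lie in some `D_H` with `η ∈ H`, and so would meet `δ_H`.
Conversely, a finite `H` for `a = s(γ)`, `b = t(γ)` gives the open set of all `D` that contain `γ`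
and none of the `γη`, `η ∈ H`. Over it the germs of `s` and `t` never agree: agreement would yield
an element of the equalizer that meets no member of `H`.

In the Zappa-Szép product the groupoid coordinate is invertible, so the order and the relation of
meeting see only the first coordinate. Right multiplication by an invertible element reduces every
pair with a common source to `(α, g)` and `(β, s(β))`. Their equalizer consists of the `(γ, k)` with
`α(g·γ) = βγ` and `φ(g, γ)k = k`, and the latter says that `φ(g, γ)` is a unit. Finite covers of
these equalizers are therefore exactly the sets `H` of the theorem. -/

namespace LCSC

universe v u v' u' w

/-! ### Ultrafilter limits, maximal sets and the topology of the tight space. -/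

section FiniteAlignment

variable {C : Type u} [Category.{v} C]

theorem Mor.comp_le_comp_left {α γ δ : Mor C} (h : γ ≤ δ) (h₁ : α.src = γ.tgt)
    (h₂ : α.src = δ.tgt) : α.comp γ h₁ ≤ α.comp δ h₂ := by
  obtain ⟨ε, h₃, rfl⟩ := h
  exact ⟨ε, h₃, (Mor.comp_assoc _ _ _ _ _).symm⟩

theorem Mor.Meets.comp_left {α γ δ : Mor C} (h : γ.Meets δ) (h₁ : α.src = γ.tgt)
    (h₂ : α.src = δ.tgt) : (α.comp γ h₁).Meets (α.comp δ h₂) := by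
  obtain ⟨ε, ⟨κ, hκ, rfl⟩, hδ⟩ := h
  exact ⟨α.comp (γ.comp κ hκ) h₁, Mor.comp_le_comp_left ⟨κ, hκ, rfl⟩ _ _,
    Mor.comp_le_comp_left hδ _ _⟩

theorem Mor.Meets.mono {γ γ' δ δ' : Mor C} (h : γ'.Meets δ') (hγ : γ ≤ γ') (hδ : δ ≤ δ') :
    γ.Meets δ := by
  obtain ⟨ε, h₁, h₂⟩ := h
  exact ⟨ε, hγ.trans h₁, hδ.trans h₂⟩

theorem meets_of_mem {D : Order.Ideal (Mor C)} {γ δ : Mor C} (hγ : γ ∈ D) (hδ : δ ∈ D) :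
    γ.Meets δ := by
  obtain ⟨ε, -, h₁, h₂⟩ := D.directed γ hγ δ hδ
  exact ⟨ε, h₁, h₂⟩

/-- The limit of a family of hereditary directed sets along an ultrafilter. -/
def ultralimit [FinitelyAligned C] {ι : Type*} (U : Ultrafilter ι)
    (D : ι → Order.Ideal (Mor C)) (x : Mor C) (hx : ∀ᶠ i in U, x ∈ D i) :
    Order.Ideal (Mor C) where
  carrier := {δ | ∀ᶠ i in U, δ ∈ D i}
  lower' := fun _ _ hle h => h.mono fun i hi => (D i).lower hle hi
  nonempty' := ⟨x, hx⟩
  directed' := by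
    intro γ hγ δ hδ
    obtain ⟨Γ, hΓ, heq⟩ := FinitelyAligned.aligned γ δ
    have h : ∀ᶠ i in U, ∃ ε ∈ Γ, ε ∈ D i := by
      filter_upwards [hγ, hδ] with i h₁ h₂
      obtain ⟨κ, hκ, h₃, h₄⟩ := (D i).directed γ h₁ δ h₂
      have hmem : κ ∈ Set.Ici γ ∩ Set.Ici δ := ⟨h₃, h₄⟩
      rw [heq] at hmem
      obtain ⟨ε, hε, hle⟩ := Set.mem_iUnion₂.1 hmem
      exact ⟨ε, hε, (D i).lower hle hκ⟩
    -- Finite alignment leaves finitely many candidates for an upper bound, so the ultrafilter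
    -- singles out one that works for almost all `i`.
    obtain ⟨ε, hε, hε'⟩ := (Ultrafilter.eventually_exists_mem_iff hΓ).1 h
    have hmem : ε ∈ Set.Ici γ ∩ Set.Ici δ := by
      rw [heq]; exact Set.mem_iUnion₂.2 ⟨ε, hε, Set.mem_Ici.2 le_rfl⟩
    exact ⟨ε, hε', hmem.1, hmem.2⟩

theorem mem_ultralimit [FinitelyAligned C] {ι : Type*} {U : Ultrafilter ι}
    {D : ι → Order.Ideal (Mor C)} {x : Mor C} {hx : ∀ᶠ i in U, x ∈ D i} {δ : Mor C} :
    δ ∈ ultralimit U D x hx ↔ ∀ᶠ i in U, δ ∈ D i := Iff.rfl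

/-- An ultrafilter limit of maximal hereditary directed sets is tight. -/
theorem isTight_ultralimit [FinitelyAligned C] {ι : Type*} {U : Ultrafilter ι}
    {D : ι → Order.Ideal (Mor C)} {x : Mor C} {hx : ∀ᶠ i in U, x ∈ D i}
    (hD : ∀ i, IsMax (D i)) : IsTight (ultralimit U D x hx) := by
  intro α hα X hX hdisj
  -- Along an ultrafilter, non-membership in the limit is eventual non-membership. As `X` is finite,
  -- one of the maximal `D i` contains `α` and avoids `X`.
  have h : ∀ᶠ i in U, ∀ η ∈ X, η ∉ D i := (Filter.eventually_all_finite hX).2 fun η hη =>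
    Ultrafilter.eventually_not.2 fun h => Set.disjoint_left.1 hdisj h hη
  obtain ⟨i, hi, hi'⟩ := ((mem_ultralimit.1 hα).and h).exists
  exact ⟨D i, hD i, hi, Set.disjoint_left.2 fun η h₁ h₂ => hi' η h₂ h₁⟩

theorem isTight_of_isMax {D : Order.Ideal (Mor C)} (hD : IsMax D) : IsTight D :=
  fun _ hα _ _ hX => ⟨D, hD, hα, hX⟩

theorem exists_isMax_mem (α : Mor C) : ∃ D : Order.Ideal (Mor C), IsMax D ∧ α ∈ D := by
  obtain ⟨D, hle, hD⟩ := zorn_le_nonempty_Ici₀ (Order.Ideal.principal α)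
    (fun c _ hc D hDc => by
      refine ⟨⟨⟨⋃ E ∈ c, (E : Set (Mor C)), ?_⟩, ?_, ?_⟩, fun E hE γ hγ =>
        Set.mem_iUnion₂.2 ⟨E, hE, hγ⟩⟩
      · intro γ δ hle h
        obtain ⟨E, hE, hγ⟩ := Set.mem_iUnion₂.1 h
        exact Set.mem_iUnion₂.2 ⟨E, hE, E.lower hle hγ⟩
      · obtain ⟨γ, hγ⟩ := D.nonempty
        exact ⟨γ, Set.mem_iUnion₂.2 ⟨D, hDc, hγ⟩⟩
      · intro γ hγ δ hδ
        obtain ⟨E, hE, hγ⟩ := Set.mem_iUnion₂.1 hγ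
        obtain ⟨E', hE', hδ⟩ := Set.mem_iUnion₂.1 hδ
        obtain ⟨K, hK, h₁, h₂⟩ := hc.directedOn E hE E' hE'
        obtain ⟨κ, hκ, h⟩ := K.directed γ (h₁ hγ) δ (h₂ hδ)
        exact ⟨κ, Set.mem_iUnion₂.2 ⟨K, hK, hκ⟩, h⟩) _ le_rfl
  exact ⟨D, hD, hle (Order.Ideal.mem_principal.2 le_rfl)⟩

/-- An element that meets every member of a maximal hereditary directed set belongs to it. -/
theorem mem_of_isMax [FinitelyAligned C] {D : Order.Ideal (Mor C)} (hD : IsMax D) {x : Mor C}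
    (h : ∀ y ∈ D, y.Meets x) : x ∈ D := by
  choose z hz hz' using fun y : {y // y ∈ D} => h y y.2
  have : Nonempty {y // y ∈ D} := D.nonempty.to_subtype
  have : IsDirectedOrder {y // y ∈ D} := ⟨fun y y' => by
    obtain ⟨κ, hκ, h₁, h₂⟩ := D.directed y y.2 y' y'.2
    exact ⟨⟨κ, hκ⟩, h₁, h₂⟩⟩
  -- With `z y` a common extension of `y` and `x`, the principal sets of the `z y` all contain `x`,
  -- and from `y` onwards they contain `y`. Their limit contains `D` and `x`, so maximality of `D`
  -- gives `x ∈ D`.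
  let U : Ultrafilter {y // y ∈ D} := Ultrafilter.of Filter.atTop
  let E := ultralimit U (fun y => Order.Ideal.principal (z y)) x
    (Filter.Eventually.of_forall fun y => Order.Ideal.mem_principal.2 (hz' y))
  have hE : D ≤ E := fun y hy => mem_ultralimit.2
    ((Ultrafilter.of_le Filter.atTop) ((Filter.eventually_ge_atTop ⟨y, hy⟩).mono
      fun y' hle => Order.Ideal.mem_principal.2 (le_trans hle (hz y'))))
  exact hD hE (mem_ultralimit.2
    (Filter.Eventually.of_forall fun y => Order.Ideal.mem_principal.2 (hz' y)))

/-- By `mem_of_isMax`, each `x ∉ D` fails to meet some member of `D`. An upper bound in `D` of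
finitely many such witnesses and of `α` serves for all of `X` at once, because not meeting `x`
passes to extensions. -/
theorem exists_not_meets_of_isMax [FinitelyAligned C] {D : Order.Ideal (Mor C)} (hD : IsMax D)
    {X : Set (Mor C)} (hX : X.Finite) (hdisj : Disjoint (D : Set (Mor C)) X) {α : Mor C}
    (hα : α ∈ D) : ∃ y ∈ D, α ≤ y ∧ ∀ x ∈ X, ¬ y.Meets x := by
  induction X, hX using Set.Finite.induction_on with
  | empty => exact ⟨α, hα, le_rfl, by simp⟩
  | @insert a X _ _ ih =>
    rw [Set.disjoint_insert_right] at hdisj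
    obtain ⟨y, hy, hle, hyX⟩ := ih hdisj.2
    obtain ⟨y', hy', hya⟩ : ∃ y' ∈ D, ¬ y'.Meets a := by
      by_contra! h
      exact hdisj.1 (mem_of_isMax hD h)
    obtain ⟨κ, hκ, h₁, h₂⟩ := D.directed y hy y' hy'
    refine ⟨κ, hκ, hle.trans h₁, ?_⟩
    rintro x (rfl | hx) hm
    · exact hya (hm.mono h₂ le_rfl)
    · exact hyX x hx (hm.mono h₁ le_rfl)

/-- The equalizer `{δ : aδ = bδ}` contains a finite set `H` such that each of its elements
meets an element of `H`. -/
def EqualizerCovered (a b : Mor C) : Prop :=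
  ∃ H : Set (Mor C), H.Finite ∧
    (∀ η ∈ H, ∃ (h : a.src = η.tgt) (h' : b.src = η.tgt), a.comp η h = b.comp η h') ∧
    ∀ (δ : Mor C) (h : a.src = δ.tgt) (h' : b.src = δ.tgt),
      a.comp δ h = b.comp δ h' → ∃ η ∈ H, δ.Meets η

theorem isOpen_setOf_mem (α : Mor C) : IsOpen {F : TightSpace C | α ∈ F.carrier} :=
  .basic _ (.inl ⟨α, rfl⟩)

theorem isOpen_setOf_notMem (α : Mor C) : IsOpen {F : TightSpace C | α ∉ F.carrier} :=
  .basic _ (.inr ⟨α, rfl⟩)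

instance : T2Space (TightSpace C) where
  t2 F G hne := by
    obtain ⟨α, hα⟩ : ∃ α, ¬ (α ∈ F.carrier ↔ α ∈ G.carrier) := by
      by_contra! h
      exact hne (tight_ext (SetLike.ext h))
    by_cases h : α ∈ F.carrier
    · exact ⟨_, _, isOpen_setOf_mem α, isOpen_setOf_notMem α, h, fun h' => hα (by simp [h, h']),
        Set.disjoint_left.2 fun _ h₁ h₂ => h₂ h₁⟩
    · exact ⟨_, _, isOpen_setOf_notMem α, isOpen_setOf_mem α, h,
        by by_contra h'; exact hα (iff_of_false h h'),
        Set.disjoint_left.2 fun _ h₁ h₂ => h₁ h₂⟩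

theorem tendsto_tightSpace {ι : Type*} {l : Filter ι} {D : ι → TightSpace C} {F : TightSpace C}
    (h : ∀ α ∈ F.carrier, ∀ᶠ i in l, α ∈ (D i).carrier)
    (h' : ∀ α ∉ F.carrier, ∀ᶠ i in l, α ∉ (D i).carrier) : Filter.Tendsto D l (nhds F) := by
  refine TopologicalSpace.tendsto_nhds_generateFrom_iff.2 ?_
  rintro _ (⟨α, rfl⟩ | ⟨α, rfl⟩) hα
  · exact h α hα
  · exact h' α hα

end FiniteAlignment

/-! ### The Hausdorff property of the tight groupoid in terms of equalizers. -/

section Hausdorff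

variable {C : Type u} [Category.{v} C] [LeftCancellative C]

/-- Both kinds of generators act on the left and hence commute with right multiplication, a property
that survives composition. Thus `s` is determined on all extensions of `γ` by its value at `γ`. -/
theorem InvSemigroup.map_comp (s : InvSemigroup C) {γ δ η : Mor C} (h : δ ∈ s.map γ)
    (hη : γ.src = η.tgt) : ∃ h' : δ.src = η.tgt, δ.comp η h' ∈ s.map (γ.comp η hη) := by
  obtain ⟨s, hs⟩ := s
  change δ ∈ s γ at h
  change ∃ h' : δ.src = η.tgt, δ.comp η h' ∈ s (γ.comp η hη)
  induction hs generalizing γ δ with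
  | shift α =>
    obtain ⟨h1, rfl⟩ := mem_shift.1 h
    exact ⟨hη, mem_shift.2 ⟨h1, (Mor.comp_assoc _ _ _ _ _).symm⟩⟩
  | prepend α =>
    obtain ⟨h1, rfl⟩ := mem_prepend.1 h
    exact ⟨hη, mem_prepend.2 ⟨h1, (Mor.comp_assoc _ _ _ _ _).symm⟩⟩
  | comp _ _ hs ht =>
    obtain ⟨ε, h1, h2⟩ := (PEquiv.mem_trans _ _ _ _).1 h
    obtain ⟨h3, h4⟩ := ht hη h1
    obtain ⟨h5, h6⟩ := hs h3 h2
    exact ⟨h5, (PEquiv.mem_trans _ _ _ _).2 ⟨_, h4, h6⟩⟩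

/-- The generator `τ^α` as an element of the inverse semigroup. -/
noncomputable def InvSemigroup.tau (α : Mor C) : InvSemigroup C := ⟨prepend α, .prepend α⟩

theorem inDom_tau {α : Mor C} {F : Order.Ideal (Mor C)} {γ : Mor C} (hγ : γ ∈ F)
    (h : α.src = γ.tgt) : InDom (.tau α) F := ⟨γ, hγ, _, mem_prepend.2 ⟨h, rfl⟩⟩

namespace TightGroupoid

variable [FinitelyAligned C]

theorem isOpen_Theta (s : InvSemigroup C) {U : Set (TightSpace C)} (hU : IsOpen U) :
    IsOpen (Theta s U) := .basic _ ⟨s, U, hU, rfl⟩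

theorem mk_mem_Theta {s : InvSemigroup C} {U : Set (TightSpace C)} {F : TightSpace C}
    (h : InDom s F.carrier) (hF : F ∈ U) : mk s F h ∈ Theta s U := ⟨F, h, hF, rfl⟩

/-- A basic neighbourhood of `[s, F]` comes from some `t` that agrees with `s` above a `γ ∈ F`.
Containing `γ` is an open condition, so `s` and `t` have the same germ at nearby sets too. -/
theorem tendsto_mk {ι : Type*} {l : Filter ι} {D : ι → TightSpace C} {F : TightSpace C}
    {s : InvSemigroup C} (hs : ∀ i, InDom s (D i).carrier) (h : InDom s F.carrier)
    (hD : Filter.Tendsto D l (nhds F)) :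
    Filter.Tendsto (fun i => mk s (D i) (hs i)) l (nhds (mk s F h)) := by
  refine TopologicalSpace.tendsto_nhds_generateFrom_iff.2 ?_
  rintro _ ⟨t, U, hU, rfl⟩ ⟨F', ht, hF', heq⟩
  obtain ⟨rfl, γ, hγ, hst⟩ := mk_eq_mk.1 heq
  filter_upwards [hD.eventually_mem (hU.mem_nhds hF'),
    hD.eventually_mem ((isOpen_setOf_mem γ).mem_nhds hγ)] with i h₁ h₂
  -- That `D i` meets the domain of `t` is seen above both `γ` and a point of the domain of `s`,
  -- where the two maps coincide.
  obtain ⟨η, hη, ε, hε⟩ := hs i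
  obtain ⟨κ, hκ, h₃, h₄⟩ := (D i).carrier.directed γ h₂ η hη
  obtain ⟨ε', hε', -⟩ := s.lift_le h₄ hε
  exact ⟨D i, ⟨κ, hκ, ε', hst κ h₃ ▸ hε'⟩, h₁, mk_eq_mk.2 ⟨rfl, γ, h₂, hst⟩⟩

/-- An equalizer without a finite cover produces a net of germs with two different limits. -/
theorem equalizerCovered_of_t2Space [T2Space (TightGroupoid C)] (a b : Mor C) :
    EqualizerCovered a b := by
  by_contra hcov
  let P : Set (Mor C) := {δ | ∃ (h : a.src = δ.tgt) (h' : b.src = δ.tgt),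
    a.comp δ h = b.comp δ h'}
  have hex : ∀ H : Finset P, ∃ δ ∈ P, ∀ η ∈ H, ¬ δ.Meets η := by
    intro H
    by_contra! h
    refine hcov ⟨Subtype.val '' (H : Set P), H.finite_toSet.image _, ?_, ?_⟩
    · rintro _ ⟨η, -, rfl⟩
      exact η.2
    · intro δ h₁ h₂ heq
      obtain ⟨η, hη, hm⟩ := h δ ⟨h₁, h₂, heq⟩
      exact ⟨η, ⟨η, hη, rfl⟩, hm⟩
  choose δ hδ hδH using hex
  choose D hD hδD using fun H => exists_isMax_mem (δ H)
  -- Different sources would make the equalizer empty and thus covered by the empty set; here `δ ∅`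
  -- is an element of it.
  have hab : a.src = b.src := (hδ ∅).1.trans (hδ ∅).2.1.symm
  have hx : ∀ H, Mor.id a.src ∈ D H := fun H =>
    (D H).lower ⟨δ H, (hδ H).1, (Mor.id_comp _ _ _).symm⟩ (hδD H)
  let U : Ultrafilter (Finset P) := Ultrafilter.of Filter.atTop
  let F : TightSpace C := ⟨ultralimit U D (Mor.id a.src) (.of_forall hx), isTight_ultralimit hD⟩
  have hxF : Mor.id a.src ∈ F.carrier := Filter.Eventually.of_forall hx
  have htend : Filter.Tendsto (fun H => (⟨D H, isTight_of_isMax (hD H)⟩ : TightSpace C)) U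
      (nhds F) := tendsto_tightSpace (fun α h => h)
    fun α h => Ultrafilter.eventually_not.2 h
  have ha := tendsto_mk (s := .tau a) (fun H => inDom_tau (hx H) rfl) (inDom_tau hxF rfl) htend
  have hb := tendsto_mk (s := .tau b) (fun H => inDom_tau (hx H) hab.symm)
    (inDom_tau hxF hab.symm) htend
  have hagree : ∀ η ∈ P, ∀ γ, η ≤ γ →
      (InvSemigroup.tau a).map γ = (InvSemigroup.tau b).map γ := by
    rintro η ⟨h₁, h₂, heq⟩ _ ⟨κ, hκ, rfl⟩
    have e₁ : (a.comp η h₁).comp κ hκ ∈ (InvSemigroup.tau a).map (η.comp κ hκ) :=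
      mem_prepend.2 ⟨h₁, (Mor.comp_assoc _ _ _ _ _).symm⟩
    have e₂ : (b.comp η h₂).comp κ hκ ∈ (InvSemigroup.tau b).map (η.comp κ hκ) :=
      mem_prepend.2 ⟨h₂, (Mor.comp_assoc _ _ _ _ _).symm⟩
    rw [Mor.comp_congr heq rfl] at e₁
    exact (Option.mem_def.1 e₁).trans (Option.mem_def.1 e₂).symm
  -- Since `δ H` lies in both `D H` and the equalizer, `τ^a` and `τ^b` have the same germ at `D H`;
  -- uniqueness of limits forces the same germ at `F`.
  have heq := tendsto_nhds_unique ha (hb.congr fun H =>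
    mk_eq_mk.2 ⟨rfl, δ H, hδD H, fun γ h => (hagree _ (hδ H) γ h).symm⟩)
  obtain ⟨-, γ, hγ, hγab⟩ := mk_eq_mk.1 heq
  -- An upper bound with the identity at `s(a)` has range `s(a)`, so that `τ^a` is defined at it.
  -- Being above `γ` as well, it lies in the equalizer.
  obtain ⟨κ, hκ, h₁, η, hη, rfl⟩ := F.carrier.directed γ hγ _ hxF
  rw [Mor.id_comp] at h₁ hκ
  have hη' : a.src = η.tgt := hη
  have hmem : a.comp η hη' ∈ (InvSemigroup.tau a).map η := mem_prepend.2 ⟨hη', rfl⟩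
  rw [hγab η h₁] at hmem
  obtain ⟨hη'', hηeq⟩ := mem_prepend.1 hmem
  have hηP : η ∈ P := ⟨hη', hη'', hηeq.symm⟩
  -- The ultrafilter refines `atTop`, so some `H` contains `η` while `η ∈ D H`. Then `η` and `δ H`
  -- meet inside `D H`, against the choice of `δ H`.
  have hle : ∀ᶠ H in (U : Filter (Finset P)), {(⟨η, hηP⟩ : P)} ≤ H :=
    Ultrafilter.of_le Filter.atTop (Filter.eventually_ge_atTop _)
  have hmemD : ∀ᶠ H in (U : Filter (Finset P)), η ∈ D H := hκ
  obtain ⟨H, hH, hH'⟩ := (hle.and hmemD).exists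
  exact hδH H ⟨η, hηP⟩ (hH (Finset.mem_singleton_self _)) (meets_of_mem (hδD H) hH')

/-- Only distinct germs over the same `F` need the covers; germs over different sets are separated
by their sources. -/
theorem t2Space_of_equalizerCovered (hcov : ∀ a b : Mor C, a.src = b.src → EqualizerCovered a b) :
    T2Space (TightGroupoid C) where
  t2 x y hne := by
    obtain ⟨s, F, hs, rfl⟩ := exists_mk x
    obtain ⟨t, G, ht, rfl⟩ := exists_mk y
    by_cases hFG : F = G
    · subst hFG
      obtain ⟨γ₁, h₁, δ₁, hδ₁⟩ := id hs
      obtain ⟨γ₂, h₂, ε₂, hε₂⟩ := id ht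
      obtain ⟨γ, hγ, hle₁, hle₂⟩ := F.carrier.directed γ₁ h₁ γ₂ h₂
      obtain ⟨δ, hδ, -⟩ := s.lift_le hle₁ hδ₁
      obtain ⟨ε, hε, -⟩ := t.lift_le hle₂ hε₂
      -- Right multiplication by an identity is used only for the equality of sources that comes
      -- with it.
      have hδs : δ.src = γ.src := (s.map_comp hδ (η := .id γ.src) rfl).1
      have hεs : ε.src = γ.src := (t.map_comp hε (η := .id γ.src) rfl).1
      obtain ⟨H, hH, hHeq, hHcov⟩ := hcov δ ε (hδs.trans hεs.symm)
      let X : Set (Mor C) := {x | ∃ η ∈ H, ∃ h : γ.src = η.tgt, γ.comp η h = x}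
      have hX : X.Finite := by
        have : X ⊆ ⋃ η ∈ H, {x | ∃ h : γ.src = η.tgt, γ.comp η h = x} := fun x ⟨η, hη, h⟩ =>
          Set.mem_iUnion₂.2 ⟨η, hη, h⟩
        refine (hH.biUnion fun η _ => Set.Subsingleton.finite ?_).subset this
        rintro _ ⟨_, rfl⟩ _ ⟨_, rfl⟩
        rfl
      -- This set is open because `X = γH` is finite.
      let U : Set (TightSpace C) := {D | γ ∈ D.carrier} ∩ ⋂ x ∈ X, {D | x ∉ D.carrier}
      have hU : IsOpen U := (isOpen_setOf_mem γ).inter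
        (hX.isOpen_biInter fun x _ => isOpen_setOf_notMem x)
      have hFU : F ∈ U := by
        refine ⟨hγ, Set.mem_iInter₂.2 ?_⟩
        rintro _ ⟨η, hη, hγη, rfl⟩ hmem
        -- If `γη ∈ F` with `η ∈ H`, then `s(γηκ) = δηκ = εηκ = t(γηκ)` for all `κ`, and the two
        -- germs would be equal.
        refine hne (mk_eq_mk.2 ⟨rfl, _, hmem, ?_⟩)
        rintro _ ⟨κ, hκ, rfl⟩
        obtain ⟨e₁, hs₁⟩ := s.map_comp hδ hγη
        obtain ⟨e₂, hs₂⟩ := t.map_comp hε hγη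
        obtain ⟨_, _, heq⟩ := hHeq η hη
        have hs₃ := (s.map_comp hs₁ hκ).2
        have ht₃ := (t.map_comp hs₂ hκ).2
        rw [Mor.comp_congr heq rfl] at hs₃
        exact (Option.mem_def.1 hs₃).trans (Option.mem_def.1 ht₃).symm
      refine ⟨_, _, isOpen_Theta s hU, isOpen_Theta t hU, mk_mem_Theta hs hFU,
        mk_mem_Theta ht hFU, Set.disjoint_left.2 ?_⟩
      rintro _ ⟨F', hs', hF', rfl⟩ ⟨F'', ht', -, heq⟩
      obtain ⟨rfl, ρ, hρ, hagree⟩ := mk_eq_mk.1 heq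
      obtain ⟨κ, hκ, hρκ, hγκ⟩ := F'.carrier.directed ρ hρ γ hF'.1
      -- Avoiding `X` is weaker than failing to meet its elements, which is what contradicts the
      -- cover. Tightness supplies a maximal set that avoids `X`, and for maximal sets the stronger
      -- property holds far enough out.
      obtain ⟨D, hD, hκD, hDX⟩ := F'.tight κ hκ X hX
        (Set.disjoint_left.2 fun x h₁ h₂ => Set.mem_iInter₂.1 hF'.2 x h₂ h₁)
      obtain ⟨y, -, hκy, hyX⟩ := exists_not_meets_of_isMax hD hX hDX hκD
      obtain ⟨ζ, hζ, rfl⟩ := hγκ.trans hκy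
      obtain ⟨e₁, hs₁⟩ := s.map_comp hδ hζ
      obtain ⟨e₂, ht₁⟩ := t.map_comp hε hζ
      rw [hagree _ (hρκ.trans hκy)] at hs₁
      -- Here `y = γζ` with `δζ = s(y) = t(y) = εζ`. So `ζ` meets some `η ∈ H`, and `y` meets `γη ∈
      -- X`.
      obtain ⟨η, hη, hm⟩ := hHcov ζ e₁ e₂ (Option.mem_unique hs₁ ht₁)
      obtain ⟨e₃, -, -⟩ := hHeq η hη
      exact hyX _ ⟨η, hη, hδs.symm.trans e₃, rfl⟩ (hm.comp_left _ _)
    · obtain ⟨U, V, hU, hV, hFU, hGV, hdisj⟩ := t2_separation hFG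
      refine ⟨_, _, isOpen_Theta s hU, isOpen_Theta t hV, mk_mem_Theta hs hFU,
        mk_mem_Theta ht hGV, Set.disjoint_left.2 ?_⟩
      rintro _ ⟨F', hs', hF', rfl⟩ ⟨G', ht', hG', heq⟩
      obtain ⟨rfl, -⟩ := mk_eq_mk.1 heq
      exact Set.disjoint_left.1 hdisj hF' hG'

/-- The tight groupoid is Hausdorff exactly when all equalizers are finitely covered. -/
theorem t2Space_iff : T2Space (TightGroupoid C) ↔
    ∀ a b : Mor C, a.src = b.src → EqualizerCovered a b :=
  ⟨fun _ a b _ => equalizerCovered_of_t2Space a b, t2Space_of_equalizerCovered⟩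

end TightGroupoid

end Hausdorff

/-- A one-sided inverse suffices: `η ↦ cη` carries the equalizer of `ac` and `bc` into that of `a`
and `b`, and every `δ` in the latter is `c(c'δ)`. Left multiplication by `c` preserves meeting, so
the image of a cover is a cover. -/
theorem EqualizerCovered.of_comp {C : Type u} [Category.{v} C] {a b c c' : Mor C}
    (ha : a.src = c.tgt) (hb : b.src = c.tgt) (hc : c.src = c'.tgt)
    (hcc : c.comp c' hc = Mor.id c.tgt) (h : EqualizerCovered (a.comp c ha) (b.comp c hb)) :
    EqualizerCovered a b := by
  obtain ⟨H, hH, hHeq, hHcov⟩ := h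
  refine ⟨{x | ∃ η ∈ H, ∃ h : c.src = η.tgt, c.comp η h = x}, ?_, ?_, ?_⟩
  · refine (hH.biUnion (t := fun η => {x | ∃ h : c.src = η.tgt, c.comp η h = x}) fun η _ =>
      Set.Subsingleton.finite ?_).subset fun x ⟨η, hη, h⟩ => Set.mem_iUnion₂.2 ⟨η, hη, h⟩
    rintro _ ⟨_, rfl⟩ _ ⟨_, rfl⟩
    rfl
  · rintro _ ⟨η, hη, h, rfl⟩
    obtain ⟨_, _, heq⟩ := hHeq η hη
    rw [Mor.comp_assoc, Mor.comp_assoc] at heq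
    exact ⟨ha, hb, heq⟩
  · intro δ h h' heq
    have hc' : c'.src = δ.tgt := (congrArg Mor.src hcc).trans (ha.symm.trans h)
    have hδ : c.comp (c'.comp δ hc') hc = δ := by
      rw [← Mor.comp_assoc, Mor.comp_congr hcc rfl, Mor.id_comp]
    obtain ⟨η, hη, hm⟩ := hHcov (c'.comp δ hc') hc hc (by
      rw [Mor.comp_assoc, Mor.comp_assoc, Mor.comp_congr rfl hδ, Mor.comp_congr rfl hδ, heq])
    obtain ⟨hη', _, _⟩ := hHeq η hη
    refine ⟨_, ⟨η, hη, hη', rfl⟩, ?_⟩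
    have := hm.comp_left hc hη'
    rwa [hδ] at this

/-! ### Inverses and cancellation in the groupoid. -/

namespace Mor

variable {G : Type u'} [Groupoid.{v'} G]

theorem exists_inverse (g : Mor G) : ∃ (k : Mor G) (h : g.src = k.tgt) (h' : k.src = g.tgt),
    g.comp k h = id g.tgt ∧ k.comp g h' = id g.src := by
  obtain ⟨g⟩ := g
  exact ⟨⟨Groupoid.inv g⟩, rfl, rfl, by simp [comp], by simp [comp]⟩

theorem eq_id_of_comp_eq {p k : Mor G} (h : p.src = k.tgt) (heq : p.comp k h = k) :
    p = id k.tgt := by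
  obtain ⟨l, hl, -, h₁, -⟩ := k.exists_inverse
  have := (comp_assoc p k l h hl).symm
  rw [comp_congr rfl h₁, comp_congr heq rfl, comp_id _ _ h, h₁] at this
  exact this

end Mor

/-! ### Equalizers in the Zappa-Szép product. -/

namespace ZappaSzep

variable {C : Type u} [Category.{v} C] {Q : Type w} [Group Q] {Γ : Submonoid Q}
  {d : LengthFunction C Γ} {G : Type u'} [Groupoid.{v'} G] {A : GroupoidAction d G}
  {φ : CategoryCocycle A}

theorem unit_pair_comp {β γ : Mor C} {k : Mor G} (hβγ : β.src = γ.tgt)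
    (hγ : γ.src = A.base k.tgt)
    (h : (pair φ β (A.unit β.src) (A.base_unit' _).symm).src = (pair φ γ k hγ).tgt) :
    (pair φ β (A.unit β.src) (A.base_unit' _).symm).comp (pair φ γ k hγ) h =
      pair φ (β.comp γ hβγ) k hγ := by
  have hg : A.base (A.unit β.src).src = γ.tgt := (A.base_unit _).trans hβγ
  rw [pair_comp _ hγ hg]
  refine pair_congr (Mor.comp_congr rfl (A.act_one _ _ hg) _) ?_ _
  have e : φ.toFun (A.unit β.src) γ hg = Mor.id k.tgt :=
    (φ.congr (congrArg A.unit hβγ) rfl hg).trans ((φ.map_unit γ).trans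
      ((congrArg A.unit hγ).trans (A.unit_base _)))
  exact (Mor.comp_congr e rfl _).trans (Mor.id_comp _ _ rfl)

/-- A left unit and a right unit coincide: the product of `(x, x)` with the identity at `x` is
computed once by the identity law and once by `unit_pair_comp`. -/
theorem pair_id (x : C) :
    pair φ (Mor.id x) (A.unit x) (A.base_unit' x).symm = Mor.id ⟨x⟩ := by
  obtain ⟨γ, k, hγ, heq⟩ := exists_pair (Mor.id (⟨x⟩ : ZappaSzep φ))
  have hx : x = γ.tgt := congrArg (fun m => m.tgt.obj) heq
  have hsrc : (pair φ (Mor.id x) (A.unit x) (A.base_unit' x).symm).src = ⟨x⟩ := by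
    rw [src_pair, A.base_unit]
  have h₁ := Mor.comp_id (pair φ (Mor.id x) (A.unit x) (A.base_unit' x).symm) ⟨x⟩ hsrc
  rw [Mor.comp_congr rfl heq] at h₁
  refine h₁.symm.trans ((unit_pair_comp (β := Mor.id x) hx hγ _).trans ?_)
  rw [heq]
  exact pair_congr (Mor.id_comp _ _ hx) rfl _

theorem pair_comp_id {α : Mor C} {g k : Mor G} {x : C} (hα : α.src = A.base g.tgt)
    (hk : (Mor.id x).src = A.base k.tgt) (hgk : g.src = k.tgt)
    (h : (pair φ α g hα).src = (pair φ (Mor.id x) k hk).tgt) :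
    (pair φ α g hα).comp (pair φ (Mor.id x) k hk) h = pair φ α (g.comp k hgk) hα := by
  obtain rfl : A.base g.src = x := congrArg obj h
  rw [pair_comp hα hk rfl]
  exact pair_congr ((Mor.comp_congr rfl (A.act_id g) _).trans (Mor.comp_id _ _ hα))
    (Mor.comp_congr (φ.map_id g) rfl _) _

/-- The second coordinates are `φ(g, γ)k` and `k`. Cancelling `k` leaves a condition on `γ` alone,
so membership in the equalizer does not depend on `k`. -/
theorem pair_comp_eq_iff {α β γ : Mor C} {g k : Mor G} (hα : α.src = A.base g.tgt)
    (hβ : A.base g.src = β.src) (hγ : γ.src = A.base k.tgt) (hβγ : β.src = γ.tgt)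
    (h : (pair φ α g hα).src = (pair φ γ k hγ).tgt)
    (h' : (pair φ β (A.unit β.src) (A.base_unit' _).symm).src = (pair φ γ k hγ).tgt) :
    (pair φ α g hα).comp (pair φ γ k hγ) h =
        (pair φ β (A.unit β.src) (A.base_unit' _).symm).comp (pair φ γ k hγ) h' ↔
      α.comp (A.act g γ (hβ.trans hβγ)) (hα.trans (A.act_tgt g γ _).symm) = β.comp γ hβγ ∧
        φ.toFun g γ (hβ.trans hβγ) = A.unit γ.src := by
  rw [unit_pair_comp hβγ hγ, pair_comp hα hγ (hβ.trans hβγ)]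
  have e : A.unit γ.src = Mor.id k.tgt := (congrArg A.unit hγ).trans (A.unit_base _)
  constructor
  · intro heq
    obtain ⟨h₁, h₂⟩ := pair_inj heq
    exact ⟨h₁, (Mor.eq_id_of_comp_eq _ h₂).trans e.symm⟩
  · rintro ⟨h₁, h₂⟩
    exact pair_congr h₁ ((Mor.comp_congr (h₂.trans e) rfl _).trans (Mor.id_comp _ _ rfl)) _

theorem meets_pair {α β : Mor C} {g k : Mor G} {hα : α.src = A.base g.tgt}
    {hβ : β.src = A.base k.tgt} : (pair φ α g hα).Meets (pair φ β k hβ) ↔ α.Meets β := by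
  constructor
  · rintro ⟨m, h₁, h₂⟩
    obtain ⟨ε, l, hε, rfl⟩ := exists_pair m
    exact ⟨ε, pair_le_pair.1 h₁, pair_le_pair.1 h₂⟩
  · rintro ⟨ε, h₁, h₂⟩
    exact ⟨pair φ ε (A.unit ε.src) (A.base_unit' _).symm, pair_le_pair.2 h₁, pair_le_pair.2 h₂⟩

/-- Neither membership in this equalizer nor meeting depends on the groupoid coordinate. Covers
therefore pass down by the first projection and up by `γ ↦ (γ, s(γ))`. -/
theorem equalizerCovered_pair_unit_iff {α β : Mor C} {g : Mor G} (hα : α.src = A.base g.tgt)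
    (hβ : A.base g.src = β.src) :
    EqualizerCovered (pair φ α g hα) (pair φ β (A.unit β.src) (A.base_unit' _).symm) ↔
      ∃ H : Set (Mor C), H.Finite ∧
        (∀ γ ∈ H, ∃ hγ : β.src = γ.tgt,
          α.comp (A.act g γ (hβ.trans hγ)) (hα.trans (A.act_tgt g γ _).symm) = β.comp γ hγ ∧
            φ.toFun g γ (hβ.trans hγ) = A.unit γ.src) ∧
        ∀ (δ : Mor C) (hδ : β.src = δ.tgt),
          α.comp (A.act g δ (hβ.trans hδ)) (hα.trans (A.act_tgt g δ _).symm) = β.comp δ hδ →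
            φ.toFun g δ (hβ.trans hδ) = A.unit δ.src → ∃ γ ∈ H, δ.Meets γ := by
  constructor
  · rintro ⟨H, hH, hHeq, hHcov⟩
    refine ⟨(fun m => Hom.fst m.hom) '' H, hH.image _, ?_, ?_⟩
    · rintro _ ⟨m, hm, rfl⟩
      obtain ⟨h, h', heq⟩ := hHeq m hm
      obtain ⟨γ, k, hγ, rfl⟩ := exists_pair m
      have hβγ : β.src = γ.tgt := hβ.symm.trans (congrArg obj h)
      exact ⟨hβγ, (pair_comp_eq_iff hα hβ hγ hβγ h h').1 heq⟩
    · intro δ hδ h₁ h₂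
      have h : (pair φ α g hα).src = (pair φ δ (A.unit δ.src) (A.base_unit' _).symm).tgt :=
        congrArg ZappaSzep.mk (hβ.trans hδ)
      have h' : (pair φ β (A.unit β.src) (A.base_unit' _).symm).src =
          (pair φ δ (A.unit δ.src) (A.base_unit' _).symm).tgt :=
        congrArg ZappaSzep.mk ((A.base_unit _).trans hδ)
      obtain ⟨m, hm, hmeets⟩ := hHcov _ h h'
        ((pair_comp_eq_iff hα hβ (A.base_unit' _).symm hδ h h').2 ⟨h₁, h₂⟩)
      refine ⟨_, ⟨m, hm, rfl⟩, ?_⟩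
      obtain ⟨γ, k, hγ, rfl⟩ := exists_pair m
      exact meets_pair.1 hmeets
  · rintro ⟨H, hH, hHeq, hHcov⟩
    refine ⟨(fun γ => pair φ γ (A.unit γ.src) (A.base_unit' _).symm) '' H, hH.image _, ?_, ?_⟩
    · rintro _ ⟨γ, hγH, rfl⟩
      obtain ⟨hβγ, heq⟩ := hHeq γ hγH
      exact ⟨congrArg ZappaSzep.mk (hβ.trans hβγ),
        congrArg ZappaSzep.mk ((A.base_unit _).trans hβγ),
        (pair_comp_eq_iff hα hβ (A.base_unit' _).symm hβγ _ _).2 heq⟩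
    · intro m h h' heq
      obtain ⟨δ, k, hδ, rfl⟩ := exists_pair m
      have hβδ : β.src = δ.tgt := hβ.symm.trans (congrArg obj h)
      obtain ⟨h₁, h₂⟩ := (pair_comp_eq_iff hα hβ hδ hβδ h h').1 heq
      obtain ⟨γ, hγ, hm⟩ := hHcov δ hβδ h₁ h₂
      exact ⟨_, ⟨γ, hγ, rfl⟩, meets_pair.2 hm⟩

/-- Right multiplication by the invertible element `(s(k), k⁻¹)` turns `(α, g)` and `(β, k)` into
`(α, gk⁻¹)` and `(β, s(β))`; `EqualizerCovered.of_comp` carries the cover back. -/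
theorem equalizerCovered_of_pair_unit
    (hcov : ∀ (α β : Mor C) (g : Mor G) (hα : α.src = A.base g.tgt) (_ : A.base g.src = β.src),
      EqualizerCovered (pair φ α g hα) (pair φ β (A.unit β.src) (A.base_unit' _).symm))
    (a b : Mor (ZappaSzep φ)) (hab : a.src = b.src) : EqualizerCovered a b := by
  obtain ⟨α, g, hα, rfl⟩ := exists_pair a
  obtain ⟨β, k, hβ, rfl⟩ := exists_pair b
  obtain ⟨l, hl, hl', hkl, hlk⟩ := k.exists_inverse
  have hgk : g.src = k.src := A.base_bijective.1 (congrArg obj hab)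
  have hgl : g.src = l.tgt := hgk.trans hl
  have hid : (Mor.id (A.base l.tgt)).src = A.base l.tgt := rfl
  have hid' : (Mor.id (A.base k.tgt)).src = A.base k.tgt := rfl
  have ha : (pair φ α g hα).src = (pair φ (Mor.id (A.base l.tgt)) l hid).tgt :=
    congrArg (fun x => ZappaSzep.mk (A.base x)) hgl
  have hb : (pair φ β k hβ).src = (pair φ (Mor.id (A.base l.tgt)) l hid).tgt :=
    congrArg (fun x => ZappaSzep.mk (A.base x)) hl
  -- Here `l = k⁻¹`, and the right inverse of `(r(l), l)` is `(r(k), k)`.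
  refine EqualizerCovered.of_comp (c' := pair φ (Mor.id (A.base k.tgt)) k hid') ha hb
    (congrArg (fun x => ZappaSzep.mk (A.base x)) hl') ?_ ?_
  · refine (pair_comp_id hid hid' hl' _).trans (Eq.trans ?_ (pair_id (A.base l.tgt)))
    refine pair_congr rfl (hlk.trans ?_) _
    rw [A.unit_base, hl]
  · rw [pair_comp_id hα hid hgl ha, pair_comp_id hβ hid hl hb]
    have e : k.comp l hl = A.unit β.src := by rw [hkl, hβ, A.unit_base]
    rw [pair_congr (φ := φ) rfl e]
    refine hcov α β (g.comp l hgl) hα ?_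
    rw [Mor.comp_src, hβ, ← hl']

end ZappaSzep

end LCSC

theorem mainTheorem4 {C : Type*} [Category C] [LeftCancellative C] [FinitelyAligned C]
    {Q : Type*} [Group Q] (Γ : Submonoid Q) (hΓ : ∀ q ∈ Γ, q⁻¹ ∈ Γ → q = 1)
    (d : LengthFunction C Γ) {G : Type*} [Groupoid G] (A : GroupoidAction d G)
    (φ : CategoryCocycle A) :
    T2Space (TightGroupoid (ZappaSzep φ)) ↔
      ∀ (α β : Mor C) (g : Mor G) (hα : α.src = A.base g.tgt) (hβ : A.base g.src = β.src),
        ∃ H : Set (Mor C), H.Finite ∧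
          (∀ γ ∈ H, ∃ hγ : β.src = γ.tgt,
            α.comp (A.act g γ (hβ.trans hγ)) (hα.trans (A.act_tgt g γ _).symm) = β.comp γ hγ ∧
              φ.toFun g γ (hβ.trans hγ) = A.unit γ.src) ∧
          ∀ (δ : Mor C) (hδ : β.src = δ.tgt),
            α.comp (A.act g δ (hβ.trans hδ)) (hα.trans (A.act_tgt g δ _).symm) = β.comp δ hδ →
              φ.toFun g δ (hβ.trans hδ) = A.unit δ.src → ∃ γ ∈ H, δ.Meets γ := by
  rw [TightGroupoid.t2Space_iff]
  constructor
  · intro h α β g hα hβ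
    exact (ZappaSzep.equalizerCovered_pair_unit_iff hα hβ).1
      (h _ _ (congrArg ZappaSzep.mk (hβ.trans (A.base_unit _).symm)))
  · intro h
    exact ZappaSzep.equalizerCovered_of_pair_unit fun α β g hα hβ =>
      (ZappaSzep.equalizerCovered_pair_unit_iff hα hβ).2 (h α β g hα hβ)
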